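/- Call $f:\{0,1\}^n\to\{0,1\}$ an $m$-junta if it depends on at most $m$ of its coordinates. Say that $f$ is $\varepsilon$-close to $g$ if $f$ and $g$ disagree on at most $\varepsilon 2^n$ points, and that $f$ is $\varepsilon$-far from $m$-juntas if it is not $\varepsilon$-close to any $m$-junta. A $(k,k',\varepsilon_1,\varepsilon_2)$-tester is a randomized, possibly adaptive algorithm with query access to a function $f:\{0,1\}^n\to\{0,1\}$ ($n$ arbitrary and known to it) that accepts with probability at least $2/3$ if $f$ is $\varepsilon_1$-close to some $k$-junta, and rejects with probability at least $2/3$ if $f$ is $\varepsilon_2$-far from $k'$-juntas. Its query complexity is the maximum number of queries it makes, over all $n$, all $f$ and all outcomes of its randomness (infinite if unbounded). (1) There are absolute constants $\gamma_0>0$ and $c>0$ such that for every integer $k\ge 1$ and all reals $\varepsilon_1,\varepsilon_2,\gamma$ with $0.01\le\varepsilon_1<\varepsilon_2\le 0.49$, $\varepsilon_2-\varepsilon_1\ge 2^{-k^{0.1}}$ and $1/k\le\gamma\le\gamma_0$, every $(k,\lfloor(1+\gamma)k\rfloor,\varepsilon_1,\varepsilon_2)$-tester has query complexity at least $$\left(\frac1\gamma\right)^{-c\log_2(\varepsilon_2-\varepsilon_1)}.$$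 (2) In particular, no $(k,k+o(k),\varepsilon_1,\varepsilon_2)$-tester makes $\mathrm{poly}(k,(\varepsilon_2-\varepsilon_1)^{-1})$ queries. Precisely: for every $h:\mathbb N\to\mathbb N$ with $h(k)=o(k)$ and all constants $C\in\mathbb R$, $d\in\mathbb N$, there is a $k_0$ such that for all $k\ge k_0$ and all $0.01\le\varepsilon_1<\varepsilon_2\le0.49$ with $2^{-k^{0.1}}\le\varepsilon_2-\varepsilon_1\le 1/k$, every $(k,k+h(k),\varepsilon_1,\varepsilon_2)$-tester has query complexity greater than $C\,\bigl(k/(\varepsilon_2-\varepsilon_1)\bigr)^{d}$. -/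

import Mathlib

/-- Boolean functions `f : {0,1}ⁿ → {0,1}`. -/
abbrev BoolFun (n : ℕ) : Type := (Fin n → Bool) → Bool

/-- `f` is an `m`-junta: its value depends on at most `m` of the coordinates. -/
def IsJunta {n : ℕ} (m : ℕ) (f : BoolFun n) : Prop :=
  ∃ S : Finset (Fin n), S.card ≤ m ∧ DependsOn f (S : Set (Fin n))

/-- `f` is `ε`-close to `g`: they disagree on at most `ε 2ⁿ` points of `{0,1}ⁿ`. -/
def IsClose {n : ℕ} (ε : ℝ) (f g : BoolFun n) : Prop :=
  ((Finset.univ.filter fun x : Fin n → Bool => f x ≠ g x).card : ℝ) ≤ ε * 2 ^ n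

/-- `f` is `ε`-close to some `m`-junta. -/
def CloseToJunta {n : ℕ} (m : ℕ) (ε : ℝ) (f : BoolFun n) : Prop :=
  ∃ g : BoolFun n, IsJunta m g ∧ IsClose ε f g

/-- `f` is `ε`-far from `m`-juntas: it is not `ε`-close to any `m`-junta. -/
def FarFromJuntas {n : ℕ} (m : ℕ) (ε : ℝ) (f : BoolFun n) : Prop :=
  ∀ g : BoolFun n, IsJunta m g → ¬ IsClose ε f g

/-- A deterministic adaptive query algorithm on Boolean functions of `n` variables: it either halts
with an answer (`true` means accept), or queries the input function at a point and
continues in a way that depends on the value it receives. -/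
inductive QueryAlg (n : ℕ) : Type
  | halt (answer : Bool) : QueryAlg n
  | query (x : Fin n → Bool) (next : Bool → QueryAlg n) : QueryAlg n

namespace QueryAlg

/-- The answer of the algorithm on input `f`. -/
def run {n : ℕ} (f : BoolFun n) : QueryAlg n → Bool
  | halt b => b
  | query x next => run f (next (f x))

/-- The number of queries that the algorithm makes on input `f`. -/
def numQueries {n : ℕ} (f : BoolFun n) : QueryAlg n → ℕ
  | halt _ => 0
  | query x next => numQueries f (next (f x)) + 1

end QueryAlg

/-- A randomized adaptive query algorithm that takes a Boolean function of any number `n` of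
variables as its input (`n` itself is known to it): for each `n`, a probability distribution over
deterministic query algorithms. -/
abbrev RandQueryAlg : Type := (n : ℕ) → PMF (QueryAlg n)

namespace RandQueryAlg

/-- The probability that the algorithm answers `b` on input `f`. -/
noncomputable def prob (T : RandQueryAlg) {n : ℕ} (f : BoolFun n) (b : Bool) : ENNReal :=
  ((T n).map (QueryAlg.run f)) b

/-- On every input and for every outcome of its randomness, the algorithm makes at most
`q` queries. -/
def MakesAtMost (T : RandQueryAlg) (q : ℕ) : Prop :=
  ∀ (n : ℕ) (f : BoolFun n), ∀ t ∈ (T n).support, t.numQueries f ≤ q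

/-- `T` is a `(k, k', ε₁, ε₂)`-tester: it accepts with probability at least `2/3` every function
that is `ε₁`-close to some `k`-junta, and it rejects with probability at least `2/3` every
function that is `ε₂`-far from `k'`-juntas. -/
def IsJuntaTester (T : RandQueryAlg) (k k' : ℕ) (ε₁ ε₂ : ℝ) : Prop :=
  ∀ (n : ℕ) (f : BoolFun n),
    (CloseToJunta k ε₁ f → 2 / 3 ≤ T.prob f true) ∧
    (FarFromJuntas k' ε₂ f → 2 / 3 ≤ T.prob f false)

end RandQueryAlg

/-! Two distributions on inputs are compared. The coordinates are grouped into `N = s + t * v`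
blocks of size `B`, and a function looks at a point only through its block parities. The first `s`
blocks are control blocks: if their parities miss `R` the value is `false`, otherwise it is read
from a uniformly random table `F`. The density of `R` is a dial that sets the distance scale.

No-instances use `F` as it is. A set of fewer than `(N - m + 1) * B` coordinates misses a point of
at least `m` blocks, and the parities of those blocks are then unpredictable. By a Chernoff bound
and a union bound, every such junta errs on almost half of the active points
(`card_random_not_far_le`).

Yes-instances hide one action block in each of the `t` rows of a `t × v` array. Whenever the hidden
parities form a codeword of `C`, they are overwritten by a fixed codeword `c` before the table is
read. On those points the hidden blocks are irrelevant, so the junta that always overwrites errs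
only on about half of the remaining active points (`card_planted_not_close_le`). The gain in
distance is proportional to the density of `C`, and the junta saves `t` whole blocks.

The two cases look alike until the algorithm queries two table cells that the overwriting
identifies. Such cells differ exactly in hidden blocks, in at least `l` rows when `C` has minimum
distance `l`. Hence a given pair is identified with probability at most `v ^ (-l)`, and `q` queries
give advantage at most `q ^ 2 * v ^ (-l)` (`card_run_planted_le`).

Gilbert–Varshamov codes of length `64 * l` have density at least `256 ^ (-l)`. So `l` of order `log
(1 / (ε₂ - ε₁))` is affordable, and `v` may be a fixed power of `1 / γ`, which gives the bound. -/

open Finset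

/-! ### Query transcripts and indistinguishability -/

namespace QueryAlg

/-- The points at which the algorithm queries the input `f`, in order. -/
def queries {n : ℕ} (f : BoolFun n) : QueryAlg n → List (Fin n → Bool)
  | halt _ => []
  | query x next => x :: queries f (next (f x))

lemma length_queries {n : ℕ} (f : BoolFun n) (t : QueryAlg n) :
    (queries f t).length = numQueries f t := by
  induction t with
  | halt b => rfl
  | query x next ih => simp [queries, numQueries, ih]

end QueryAlg

/-- A finite injective relabelling extends to a permutation. -/
lemma exists_perm_eqOn {X : Type*} [Finite X] (ψ : X → X) (Q : Set X) (h : Set.InjOn ψ Q) :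
    ∃ σ : Equiv.Perm X, Set.EqOn σ ψ Q := by
  classical
  refine ⟨(Equiv.Set.imageOfInjOn ψ Q h).extendSubtype, fun x hx => ?_⟩
  exact (Equiv.extendSubtype_apply_of_mem (p := (· ∈ Q)) (q := (· ∈ ψ '' Q)) _ x hx).trans rfl

/-- The function on the cube obtained by reading the table `F` through `ψ ∘ π` and observing the
entry through `obs`. -/
def lookup {n : ℕ} {X : Type*} (π : (Fin n → Bool) → X) (obs : (Fin n → Bool) → Bool → Bool)
    (ψ : X → X) (F : X → Bool) : BoolFun n :=
  fun y => obs y (F (ψ (π y)))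

section Transfer

variable {n : ℕ} {X : Type*} [Fintype X] [DecidableEq X]

open Classical in
/-- The runs on which `ψ` does not identify two queried cells have the same distribution for a
uniformly random table read through `ψ` as for one that is read directly. -/
lemma card_lookup_eq (π : (Fin n → Bool) → X) (obs : (Fin n → Bool) → Bool → Bool)
    (ψ : X → X) (R : Bool → Prop) (t : QueryAlg n) (L : List ((Fin n → Bool) × Bool)) :
    #{F : X → Bool | (∀ p ∈ L, lookup π obs ψ F p.1 = p.2) ∧ R (t.run (lookup π obs ψ F)) ∧
        Set.InjOn ψ (π '' {y | y ∈ L.map Prod.fst ∨ y ∈ t.queries (lookup π obs ψ F)})} =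
    #{F : X → Bool | (∀ p ∈ L, lookup π obs id F p.1 = p.2) ∧ R (t.run (lookup π obs id F)) ∧
        Set.InjOn ψ (π '' {y | y ∈ L.map Prod.fst ∨ y ∈ t.queries (lookup π obs id F)})} := by
  induction t generalizing L with
  | halt b =>
    simp only [QueryAlg.run, QueryAlg.queries, List.not_mem_nil, or_false]
    by_cases hinj : Set.InjOn ψ (π '' {y | y ∈ L.map Prod.fst})
    -- At a leaf the transcript `L` fixes the queried cells, so `ψ` acts on them like a permutation
    -- `σ`. Composition with `σ` preserves the uniform distribution on tables.
    · obtain ⟨σ, hσ⟩ := exists_perm_eqOn ψ _ hinj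
      refine Finset.card_bijective (fun F => F ∘ σ)
        (σ.arrowCongr (Equiv.refl Bool)).symm.bijective fun F => ?_
      simp only [mem_filter, mem_univ, true_and, and_congr_left_iff]
      intro _
      refine forall₂_congr fun p hp => ?_
      have : σ (π p.1) = ψ (π p.1) := hσ ⟨p.1, List.mem_map_of_mem hp, rfl⟩
      simp [lookup, this]
    · simp only [hinj, and_false]
  | query x next ih =>
    have key : ∀ f : BoolFun n,
        ((∀ p ∈ L, f p.1 = p.2) ∧ R ((QueryAlg.query x next).run f) ∧
          Set.InjOn ψ (π '' {y | y ∈ L.map Prod.fst ∨ y ∈ (QueryAlg.query x next).queries f})) ↔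
        (((∀ p ∈ (x, true) :: L, f p.1 = p.2) ∧ R ((next true).run f) ∧
          Set.InjOn ψ (π '' {y | y ∈ ((x, true) :: L).map Prod.fst ∨ y ∈ (next true).queries f})) ∨
        ((∀ p ∈ (x, false) :: L, f p.1 = p.2) ∧ R ((next false).run f) ∧
          Set.InjOn ψ
            (π '' {y | y ∈ ((x, false) :: L).map Prod.fst ∨ y ∈ (next false).queries f}))) := by
      intro f
      have hset : ∀ b, {y | y ∈ ((x, b) :: L).map Prod.fst ∨ y ∈ (next b).queries f} =
          {y | y ∈ L.map Prod.fst ∨ y ∈ x :: (next b).queries f} := by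
        intro b; ext y
        simp only [List.map_cons, List.mem_cons, Set.mem_ofPred_eq]
        tauto
      rw [hset, hset]
      simp only [QueryAlg.run, QueryAlg.queries, List.forall_mem_cons]
      rcases h : f x <;> simp
    -- The two possible answers at `x` partition the tables; each answer is appended to the
    -- transcript.
    have split : ∀ φ : X → X,
        #{F : X → Bool | (∀ p ∈ L, lookup π obs φ F p.1 = p.2) ∧
            R ((QueryAlg.query x next).run (lookup π obs φ F)) ∧
            Set.InjOn ψ (π '' {y | y ∈ L.map Prod.fst ∨
              y ∈ (QueryAlg.query x next).queries (lookup π obs φ F)})} =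
        ∑ b : Bool, #{F : X → Bool | (∀ p ∈ (x, b) :: L, lookup π obs φ F p.1 = p.2) ∧
            R ((next b).run (lookup π obs φ F)) ∧
            Set.InjOn ψ (π '' {y | y ∈ ((x, b) :: L).map Prod.fst ∨
              y ∈ (next b).queries (lookup π obs φ F)})} := by
      intro φ
      rw [Fintype.sum_bool, ← Finset.card_union_of_disjoint]
      · rw [← Finset.filter_or]
        congr 1
        ext F
        simp only [mem_filter, mem_univ, true_and]
        exact key _
      · rw [Finset.disjoint_filter]
        rintro F - ⟨h1, -⟩ ⟨h2, -⟩
        have a := h1 (x, true) (by simp)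
        have b := h2 (x, false) (by simp)
        simp_all
    rw [split ψ, split id]
    exact Finset.sum_congr rfl fun b _ => ih b _

-- Collision-free runs correspond by `card_lookup_eq`. Taking the trivial event there shows that
-- collisions are equally frequent in both models, so they can be counted for `id`, where the
-- queries do not depend on `ψ`.
open Classical in
lemma card_run_lookup_le (π : (Fin n → Bool) → X) (obs : (Fin n → Bool) → Bool → Bool)
    (ψ : X → X) (t : QueryAlg n) :
    #{F : X → Bool | t.run (lookup π obs ψ F) = true} ≤
      #{F : X → Bool | t.run (lookup π obs id F) = true} +
      #{F : X → Bool | ¬ Set.InjOn ψ (π '' {y | y ∈ t.queries (lookup π obs id F)})} := by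
  have h1 := card_lookup_eq π obs ψ (fun b => b = true) t []
  have h2 := card_lookup_eq π obs ψ (fun _ => True) t []
  simp only [List.not_mem_nil, false_implies, implies_true, true_and, List.map_nil,
    false_or] at h1 h2
  have h3 := Finset.card_filter_add_card_filter_not (s := (univ : Finset (X → Bool)))
    (fun F => Set.InjOn ψ (π '' {y | y ∈ t.queries (lookup π obs ψ F)}))
  have h4 := Finset.card_filter_add_card_filter_not (s := (univ : Finset (X → Bool)))
    (fun F => Set.InjOn ψ (π '' {y | y ∈ t.queries (lookup π obs id F)}))
  have h5 : #{F : X → Bool | t.run (lookup π obs ψ F) = true} ≤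
      #{F : X → Bool | t.run (lookup π obs ψ F) = true ∧
        Set.InjOn ψ (π '' {y | y ∈ t.queries (lookup π obs ψ F)})} +
      #{F : X → Bool | ¬ Set.InjOn ψ (π '' {y | y ∈ t.queries (lookup π obs ψ F)})} := by
    refine le_trans (Finset.card_le_card ?_) (Finset.card_union_le _ _)
    intro F
    simp only [mem_filter, mem_univ, true_and, mem_union]
    tauto
  have h6 : #{F : X → Bool | t.run (lookup π obs id F) = true ∧
        Set.InjOn ψ (π '' {y | y ∈ t.queries (lookup π obs id F)})} ≤
      #{F : X → Bool | t.run (lookup π obs id F) = true} := by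
    refine Finset.card_le_card fun F => ?_
    simp only [mem_filter, mem_univ, true_and]
    tauto
  omega

end Transfer

open Classical in
/-- If, for each pair of distinct cells, at most `c` of the maps `ψ e` identify the pair, then an
algorithm that makes at most `q` queries notices a collision for at most `q * q * c` of them. -/
lemma card_not_injOn_le {E X Y : Type*} [Fintype E] [DecidableEq X] (ψ : E → X → X) (c : ℕ)
    (hc : ∀ x x', x ≠ x' → #{e | ψ e x = ψ e x'} ≤ c) (π : Y → X) (Q : List Y) (q : ℕ)
    (hQ : Q.length ≤ q) :
    #{e | ¬ Set.InjOn (ψ e) (π '' {y | y ∈ Q})} ≤ q * q * c := by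
  have hsub : ({e | ¬ Set.InjOn (ψ e) (π '' {y | y ∈ Q})} : Finset E) ⊆
      (Q.toFinset ×ˢ Q.toFinset).biUnion
        fun p => {e | π p.1 ≠ π p.2 ∧ ψ e (π p.1) = ψ e (π p.2)} := by
    intro e he
    simp only [mem_filter, mem_univ, true_and, Set.InjOn, not_forall] at he
    obtain ⟨_, ⟨y, hy, rfl⟩, _, ⟨y', hy', rfl⟩, h, hne⟩ := he
    simp only [mem_biUnion, mem_product, List.mem_toFinset, mem_filter, mem_univ, true_and,
      Prod.exists]
    exact ⟨y, y', ⟨hy, hy'⟩, hne, h⟩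
  refine (card_le_card hsub).trans (card_biUnion_le.trans ?_)
  have hb : ∀ p ∈ Q.toFinset ×ˢ Q.toFinset,
      #{e | π p.1 ≠ π p.2 ∧ ψ e (π p.1) = ψ e (π p.2)} ≤ c := by
    intro p _
    by_cases h : π p.1 = π p.2
    · simp [h]
    · exact (card_le_card fun e => by simp).trans (hc _ _ h)
  refine (sum_le_card_nsmul _ _ _ hb).trans ?_
  rw [card_product, smul_eq_mul]
  have := (List.toFinset_card_le Q).trans hQ
  gcongr

open Classical in
/-- Two families of inputs between which every deterministic algorithm in the support of `p`
distinguishes with small advantage cannot be told apart by `p`. -/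
lemma false_of_indistinguishable {n : ℕ} (p : PMF (QueryAlg n)) {Ω : Type*} [Fintype Ω]
    [Nonempty Ω] (fy fn : Ω → BoolFun n) (K : ℕ) (hK : 16 * K ≤ Fintype.card Ω)
    (hdet : ∀ t ∈ p.support,
      #{ω | t.run (fy ω) = true} ≤ #{ω | t.run (fn ω) = true} + K)
    (hy : 16 * #{ω | ¬ 2 / 3 ≤ (p.map (QueryAlg.run (fy ω))) true} ≤ Fintype.card Ω)
    (hn : 16 * #{ω | ¬ 2 / 3 ≤ (p.map (QueryAlg.run (fn ω))) false} ≤ Fintype.card Ω) :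
    False := by
  -- Exchanging the sums reduces a randomized algorithm to an average of deterministic ones.
  have hsum : ∀ f : Ω → BoolFun n, ∑ ω, (p.map (QueryAlg.run (f ω))) true =
      ∑' t, p t * (#{ω | t.run (f ω) = true} : ENNReal) := by
    intro f
    simp only [PMF.map_apply]
    rw [← Summable.tsum_finsetSum (fun _ _ => ENNReal.summable)]
    refine tsum_congr fun t => ?_
    rw [Finset.card_filter]
    push_cast
    rw [Finset.mul_sum]
    refine Finset.sum_congr rfl fun ω _ => ?_
    by_cases h : t.run (f ω) = true <;> simp [h]
  have hle : ∑ ω, (p.map (QueryAlg.run (fy ω))) true ≤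
      ∑ ω, (p.map (QueryAlg.run (fn ω))) true + K := by
    rw [hsum, hsum]
    calc ∑' t, p t * (#{ω | t.run (fy ω) = true} : ENNReal)
        ≤ ∑' t, (p t * (#{ω | t.run (fn ω) = true} : ENNReal) + p t * K) := by
          refine ENNReal.tsum_le_tsum fun t => ?_
          by_cases ht : t ∈ p.support
          · rw [← mul_add]
            gcongr
            exact_mod_cast hdet t ht
          · have : p t = 0 := by simpa [PMF.mem_support_iff] using ht
            simp [this]
      _ = _ := by
          rw [ENNReal.tsum_add, ENNReal.tsum_mul_right, PMF.tsum_coe, one_mul]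
  have htop : ∀ (f : BoolFun n) (b : Bool), (p.map (QueryAlg.run f)) b ≠ ⊤ :=
    fun f b => PMF.apply_ne_top _ _
  have hone : ∀ f : BoolFun n, ((p.map (QueryAlg.run f)) true).toReal +
      ((p.map (QueryAlg.run f)) false).toReal = 1 := by
    intro f
    have h := PMF.tsum_coe (p.map (QueryAlg.run f))
    rw [tsum_fintype, Fintype.sum_bool] at h
    rw [← ENNReal.toReal_add (htop _ _) (htop _ _), h, ENNReal.toReal_one]
  have hleR : ∑ ω, ((p.map (QueryAlg.run (fy ω))) true).toReal ≤
      ∑ ω, ((p.map (QueryAlg.run (fn ω))) true).toReal + K := by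
    have := ENNReal.toReal_mono (by simp [htop, -PMF.map_apply]) hle
    rw [ENNReal.toReal_add (by simp [htop, -PMF.map_apply]) (by simp),
      ENNReal.toReal_sum (fun _ _ => htop _ _), ENNReal.toReal_sum (fun _ _ => htop _ _)] at this
    simpa using this
  have h23 : ∀ (f : BoolFun n) (b : Bool), 2 / 3 ≤ (p.map (QueryAlg.run f)) b →
      (2 / 3 : ℝ) ≤ ((p.map (QueryAlg.run f)) b).toReal := by
    intro f b h
    have := ENNReal.toReal_mono (htop f b) h
    simpa using this
  -- Here `5/8 = (2/3) * (15/16)`. Average acceptance is then at least `5/8` on one family and at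
  -- most `3/8` on the other, against an allowed advantage of `1/16`.
  have low : ∀ (f : Ω → BoolFun n) (b : Bool),
      16 * #{ω | ¬ 2 / 3 ≤ (p.map (QueryAlg.run (f ω))) b} ≤ Fintype.card Ω →
      (5 / 8 : ℝ) * Fintype.card Ω ≤ ∑ ω, ((p.map (QueryAlg.run (f ω))) b).toReal := by
    intro f b h
    have h1 : ∑ ω, (2 / 3 - (2 / 3 : ℝ) *
        (if ¬ 2 / 3 ≤ (p.map (QueryAlg.run (f ω))) b then 1 else 0)) ≤
        ∑ ω, ((p.map (QueryAlg.run (f ω))) b).toReal := by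
      refine Finset.sum_le_sum fun ω _ => ?_
      split_ifs with h2
      · have := h23 _ _ h2
        linarith
      · simp
    rw [Finset.sum_sub_distrib, ← Finset.mul_sum, Finset.sum_boole] at h1
    simp only [sum_const, card_univ, nsmul_eq_mul] at h1
    have h' : (16 : ℝ) * #{ω | ¬ 2 / 3 ≤ (p.map (QueryAlg.run (f ω))) b} ≤ Fintype.card Ω := by
      exact_mod_cast h
    linarith
  have hy' := low fy true hy
  have hn' := low fn false hn
  have hfn : ∑ ω, ((p.map (QueryAlg.run (fn ω))) true).toReal +
      ∑ ω, ((p.map (QueryAlg.run (fn ω))) false).toReal = Fintype.card Ω := by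
    rw [← Finset.sum_add_distrib]
    simp [hone, -PMF.map_apply]
  have hpos : (0 : ℝ) < Fintype.card Ω := by exact_mod_cast Fintype.card_pos
  have hK' : (16 : ℝ) * K ≤ Fintype.card Ω := by exact_mod_cast hK
  linarith

/-! ### Concentration for random Boolean functions -/

/-- A Chernoff bound: a uniformly random Boolean function rarely agrees with `G` on noticeably more
than half of `U`. -/
lemma card_few_disagreements_le {X : Type*} [Fintype X] [DecidableEq X] (U : Finset X)
    (G : X → Bool) {a K : ℝ} (ha : 0 < a) (hK : 0 < K) (hU : (#U : ℝ) ≤ K) :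
    (#{F : X → Bool | (#{x ∈ U | F x ≠ G x} : ℝ) ≤ #U / 2 - a} : ℝ) ≤
      2 ^ Fintype.card X * Real.exp (-(2 * a ^ 2 / K)) := by
  -- The minimizer of `l ^ 2 / 8 * K - l * a`, the exponent given by Markov's inequality for the
  -- exponential moment.
  set l : ℝ := 4 * a / K with hl
  have hl0 : 0 < l := by positivity
  let w : X → Bool → ℝ := fun x b =>
    if x ∈ U then (if b ≠ G x then Real.exp (-(l / 2)) else Real.exp (l / 2)) else 1
  have hw : ∀ x, ∑ b, w x b ≤ 2 * (if x ∈ U then Real.exp (l ^ 2 / 8) else 1) := by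
    intro x
    have hc : Real.exp (l / 2) + Real.exp (-(l / 2)) ≤ 2 * Real.exp (l ^ 2 / 8) := by
      have h := Real.cosh_le_exp_half_sq (l / 2)
      rw [Real.cosh_eq] at h
      have : (l / 2) ^ 2 / 2 = l ^ 2 / 8 := by ring
      rw [this] at h
      linarith
    rw [Fintype.sum_bool]
    by_cases hx : x ∈ U
    · rcases hG : G x <;> simp [w, hx, hG] <;> linarith
    · simp [w, hx]; norm_num
  have hprod : ∀ F : X → Bool, ∏ x, w x (F x) =
      Real.exp (l * (#U / 2 - #{x ∈ U | F x ≠ G x})) := by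
    intro F
    have : ∏ x, w x (F x) = ∏ x ∈ U, Real.exp (l / 2 - l * (if F x ≠ G x then 1 else 0)) := by
      rw [← Finset.prod_filter_mul_prod_filter_not univ (· ∈ U),
        Finset.prod_eq_one (s := univ.filter fun x => ¬ x ∈ U) (by simp +contextual [w]), mul_one]
      rw [Finset.filter_mem_eq_inter, Finset.univ_inter]
      refine Finset.prod_congr rfl fun x hx => ?_
      simp only [w, hx, if_true]
      split_ifs <;> congr 1 <;> ring
    rw [this, ← Real.exp_sum, Finset.sum_sub_distrib, ← Finset.mul_sum, Finset.sum_boole]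
    simp only [sum_const, nsmul_eq_mul]
    congr 1
    ring
  have hw0 : ∀ x b, 0 ≤ w x b := by
    intro x b
    simp only [w]
    split_ifs <;> positivity
  have htotal : ∑ F : X → Bool, ∏ x, w x (F x) ≤
      2 ^ Fintype.card X * Real.exp (l ^ 2 / 8 * K) := by
    have h := Finset.prod_univ_sum (fun _ : X => (univ : Finset Bool)) w
    rw [Fintype.piFinset_univ] at h
    rw [← h]
    refine (Finset.prod_le_prod (fun x _ => Finset.sum_nonneg fun b _ => hw0 x b)
      (fun x _ => hw x)).trans ?_
    rw [Finset.prod_mul_distrib, Finset.prod_const, Finset.card_univ, Finset.prod_ite_mem,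
      Finset.univ_inter, Finset.prod_const, ← Real.exp_nat_mul]
    rw [mul_comm (l ^ 2 / 8) K]
    gcongr
  have hmarkov : (#{F : X → Bool | (#{x ∈ U | F x ≠ G x} : ℝ) ≤ #U / 2 - a} : ℝ) *
      Real.exp (l * a) ≤ ∑ F : X → Bool, ∏ x, w x (F x) := by
    rw [← nsmul_eq_mul]
    refine (Finset.card_nsmul_le_sum _ (fun F : X → Bool => ∏ x, w x (F x)) _ ?_).trans
      (Finset.sum_le_sum_of_subset_of_nonneg (Finset.filter_subset _ _)
        fun F _ _ => Finset.prod_nonneg fun x _ => hw0 x _)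
    intro F hF
    rw [mem_filter] at hF
    rw [hprod]
    gcongr
    linarith [hF.2]
  have h := hmarkov.trans htotal
  rw [← le_div_iff₀ (Real.exp_pos _), mul_div_assoc, ← Real.exp_sub] at h
  refine h.trans (le_of_eq ?_)
  congr 2
  rw [hl]
  field_simp
  ring

lemma card_boolFun_zmod (I : Type*) [Fintype I] [DecidableEq I] :
    Fintype.card ((I → ZMod 2) → Bool) = 2 ^ 2 ^ Fintype.card I := by
  simp [ZMod.card]

open Classical in
lemma card_dependsOn_le {I : Type*} [Fintype I] [DecidableEq I] (M : Finset I) :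
    #{H : (I → ZMod 2) → Bool | DependsOn H ((M : Set I)ᶜ)} ≤ 2 ^ 2 ^ (Fintype.card I - #M) := by
  have hsub : ({H : (I → ZMod 2) → Bool | DependsOn H ((M : Set I)ᶜ)} : Finset _) ⊆
      (univ : Finset ((((M : Set I)ᶜ : Set I) → ZMod 2) → Bool)).image
        (fun g => g ∘ ((M : Set I)ᶜ).domRestrict) := by
    intro H hH
    obtain ⟨g, rfl⟩ := dependsOn_iff_exists_comp.1 (mem_filter.1 hH).2
    exact mem_image_of_mem _ (mem_univ g)
  refine (card_le_card hsub).trans (card_image_le.trans (le_of_eq ?_))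
  rw [card_univ, card_boolFun_zmod]
  congr 2
  rw [Fintype.card_compl_set]
  simp

open Classical in
/-- A random Boolean function is, with high probability, far on `W` from every function that
ignores some `m` of the coordinates. -/
lemma card_near_junta_le {I : Type*} [Fintype I] [DecidableEq I] (W : Finset (I → ZMod 2))
    {m : ℕ} {τ : ℝ} (hτ : 0 < τ) (hm : m ≤ Fintype.card I)
    (hI : Fintype.card I ≤ 2 ^ (Fintype.card I - m)) (hτm : 8 ≤ τ ^ 2 * 2 ^ m) :
    16 * #{F : (I → ZMod 2) → Bool | ∃ M : Finset I, #M = m ∧ ∃ H : (I → ZMod 2) → Bool,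
        DependsOn H ((M : Set I)ᶜ) ∧
        (#{x ∈ W | F x ≠ H x} : ℝ) ≤ #W / 2 - τ * 2 ^ Fintype.card I} ≤
      Fintype.card ((I → ZMod 2) → Bool) := by
  set N := Fintype.card I with hN
  set P := 2 ^ (N - m) with hP
  have hX : Fintype.card (I → ZMod 2) = 2 ^ N := by simp [ZMod.card, hN]
  have hW : (#W : ℝ) ≤ 2 ^ N := by
    have := Finset.card_le_univ W
    rw [hX] at this
    exact_mod_cast this
  -- For fixed `H` the Chernoff exponent is `2 * τ ^ 2 * 2 ^ m * P ≥ 16 * P`. This beats the union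
  -- bound over at most `2 ^ P` sets `M` and, for each, at most `2 ^ P` functions `H`.
  set E : ℝ := 2 ^ 2 ^ N * Real.exp (-(16 * P)) with hE
  have hone : ∀ H : (I → ZMod 2) → Bool,
      (#{F : (I → ZMod 2) → Bool | (#{x ∈ W | F x ≠ H x} : ℝ) ≤ #W / 2 - τ * 2 ^ N} : ℝ) ≤ E := by
    intro H
    refine (card_few_disagreements_le W H (a := τ * 2 ^ N) (K := 2 ^ N) (by positivity)
      (by positivity) hW).trans ?_
    rw [hX, hE]
    gcongr
    have h1 : 2 * (τ * 2 ^ N) ^ 2 / 2 ^ N = 2 * (τ ^ 2 * 2 ^ m) * (P : ℝ) := by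
      have : (2 : ℝ) ^ N = 2 ^ m * P := by
        rw [hP]; push_cast; rw [← pow_add]; congr 1; omega
      field_simp
      rw [this]
    rw [h1]
    have : (0 : ℝ) ≤ P := by positivity
    nlinarith
  have hsub : ({F : (I → ZMod 2) → Bool | ∃ M : Finset I, #M = m ∧ ∃ H : (I → ZMod 2) → Bool,
        DependsOn H ((M : Set I)ᶜ) ∧
        (#{x ∈ W | F x ≠ H x} : ℝ) ≤ #W / 2 - τ * 2 ^ N} : Finset _) ⊆
      (powersetCard m (univ : Finset I)).biUnion fun M =>
        ({H : (I → ZMod 2) → Bool | DependsOn H ((M : Set I)ᶜ)} : Finset _).biUnion fun H =>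
          {F : (I → ZMod 2) → Bool | (#{x ∈ W | F x ≠ H x} : ℝ) ≤ #W / 2 - τ * 2 ^ N} := by
    intro F hF
    obtain ⟨-, M, hM, H, hH, h⟩ := mem_filter.1 hF
    simp only [mem_biUnion, mem_powersetCard, mem_filter, mem_univ, true_and, subset_univ]
    exact ⟨M, hM, H, hH, h⟩
  have hcard : (#{F : (I → ZMod 2) → Bool | ∃ M : Finset I, #M = m ∧ ∃ H : (I → ZMod 2) → Bool,
        DependsOn H ((M : Set I)ᶜ) ∧
        (#{x ∈ W | F x ≠ H x} : ℝ) ≤ #W / 2 - τ * 2 ^ N} : ℝ) ≤ 2 ^ P * (2 ^ P * E) := by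
    have h1 := (card_le_card hsub).trans card_biUnion_le
    have h2 : ∀ M ∈ powersetCard m (univ : Finset I),
        (#(({H : (I → ZMod 2) → Bool | DependsOn H ((M : Set I)ᶜ)} : Finset _).biUnion fun H =>
          {F : (I → ZMod 2) → Bool | (#{x ∈ W | F x ≠ H x} : ℝ) ≤ #W / 2 - τ * 2 ^ N}) : ℝ) ≤
          2 ^ P * E := by
      intro M hM
      have h3 : (#(({H : (I → ZMod 2) → Bool | DependsOn H ((M : Set I)ᶜ)} : Finset _).biUnion
          fun H => {F : (I → ZMod 2) → Bool |
            (#{x ∈ W | F x ≠ H x} : ℝ) ≤ #W / 2 - τ * 2 ^ N}) : ℝ) ≤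
          ∑ H ∈ ({H : (I → ZMod 2) → Bool | DependsOn H ((M : Set I)ᶜ)} : Finset _), E := by
        refine le_trans (Nat.cast_le.2 card_biUnion_le) ?_
        rw [Nat.cast_sum]
        exact Finset.sum_le_sum fun H _ => hone H
      refine h3.trans ?_
      rw [sum_const, nsmul_eq_mul]
      gcongr
      have := card_dependsOn_le M
      rw [(mem_powersetCard.1 hM).2] at this
      exact_mod_cast this
    refine le_trans (Nat.cast_le.2 h1) ?_
    rw [Nat.cast_sum]
    refine (Finset.sum_le_sum h2).trans ?_
    rw [sum_const, nsmul_eq_mul]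
    gcongr
    rw [card_powersetCard, card_univ]
    have : N.choose m ≤ 2 ^ P := (Nat.choose_le_two_pow _ _).trans (Nat.pow_le_pow_right (by norm_num) hI)
    exact_mod_cast this
  rw [card_boolFun_zmod, ← hN]
  have hexp : 2 ^ P * (2 ^ P * Real.exp (-(16 * P))) ≤ 1 / 16 := by
    have h16 : (64 : ℝ) ≤ Real.exp 16 := by
      have h1 : (2 : ℝ) ≤ Real.exp 1 := by linarith [Real.add_one_le_exp (1 : ℝ)]
      have h2 : Real.exp 16 = Real.exp 1 ^ 16 := by rw [← Real.exp_nat_mul]; norm_num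
      rw [h2]
      calc (64 : ℝ) ≤ 2 ^ 16 := by norm_num
        _ ≤ _ := by gcongr
    have h3 : Real.exp (-(16 * P)) = (Real.exp 16)⁻¹ ^ P := by
      rw [← Real.exp_neg, ← Real.exp_nat_mul]; congr 1; ring
    have h4 : (Real.exp 16)⁻¹ ≤ 1 / 64 := by
      rw [inv_eq_one_div]; gcongr
    rw [h3, ← mul_pow, ← mul_pow]
    calc (2 * (2 * (Real.exp 16)⁻¹)) ^ P ≤ (1 / 16 : ℝ) ^ P := by
          gcongr; linarith
      _ ≤ (1 / 16 : ℝ) ^ 1 := pow_le_pow_of_le_one (by norm_num) (by norm_num) Nat.one_le_two_pow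
      _ = 1 / 16 := pow_one _
  have hfin : (2 : ℝ) ^ P * (2 ^ P * E) ≤ 2 ^ 2 ^ N / 16 := by
    rw [hE]
    calc (2 : ℝ) ^ P * (2 ^ P * (2 ^ 2 ^ N * Real.exp (-(16 * P))))
        = 2 ^ 2 ^ N * (2 ^ P * (2 ^ P * Real.exp (-(16 * P)))) := by ring
      _ ≤ 2 ^ 2 ^ N * (1 / 16) := by gcongr
      _ = _ := by ring
  have := hcard.trans hfin
  have h' : (16 : ℝ) * (#{F : (I → ZMod 2) → Bool | ∃ M : Finset I, #M = m ∧
      ∃ H : (I → ZMod 2) → Bool, DependsOn H ((M : Set I)ᶜ) ∧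
        (#{x ∈ W | F x ≠ H x} : ℝ) ≤ #W / 2 - τ * 2 ^ N} : ℝ) ≤ 2 ^ 2 ^ N := by linarith
  exact_mod_cast h'

/-! ### Codes -/

/-- Weighting `y` by `(1/32) ^ hammingDist x y` makes the total factor over coordinates. The base
`32` suits length `64 * l`, since `32 * (33/32) ^ 64 ≤ 256`. -/
lemma card_hammingBall_le (t l : ℕ) (x : Fin t → ZMod 2) :
    (#{y : Fin t → ZMod 2 | hammingDist x y < l} : ℝ) ≤ 32 ^ l * (33 / 32) ^ t := by
  let w : Fin t → ZMod 2 → ℝ := fun j b => if x j ≠ b then 1 / 32 else 1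
  have hw : ∀ j, ∑ b, w j b = 33 / 32 := by
    intro j
    have h : ∀ a : ZMod 2, ∑ b : ZMod 2, (if a ≠ b then (1 / 32 : ℝ) else 1) = 33 / 32 := by
      intro a
      have : (univ : Finset (ZMod 2)) = {0, 1} := rfl
      rw [this, sum_pair (by decide)]
      rcases (by decide : ∀ a : ZMod 2, a = 0 ∨ a = 1) a with rfl | rfl <;> norm_num
    exact h (x j)
  have hprod : ∀ y : Fin t → ZMod 2, ∏ j, w j (y j) = (1 / 32 : ℝ) ^ hammingDist x y := by
    intro y
    simp only [w, hammingDist]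
    rw [Finset.prod_ite]
    simp
  have htotal : ∑ y : Fin t → ZMod 2, (1 / 32 : ℝ) ^ hammingDist x y = (33 / 32) ^ t := by
    have h := Finset.prod_univ_sum (fun _ : Fin t => (univ : Finset (ZMod 2))) w
    rw [Fintype.piFinset_univ] at h
    simp only [← hprod]
    rw [← h]
    simp only [hw, prod_const, card_univ, Fintype.card_fin]
  have : (#{y : Fin t → ZMod 2 | hammingDist x y < l} : ℝ) ≤
      ∑ y : Fin t → ZMod 2, 32 ^ l * (1 / 32 : ℝ) ^ hammingDist x y := by
    rw [Finset.card_filter]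
    push_cast
    refine Finset.sum_le_sum fun y _ => ?_
    split_ifs with hy
    · calc (1 : ℝ) = 32 ^ hammingDist x y * (1 / 32) ^ hammingDist x y := by
            rw [← mul_pow]; norm_num
        _ ≤ _ := by gcongr; norm_num
    · positivity
  rwa [← Finset.mul_sum, htotal] at this

/-- The Gilbert–Varshamov bound, for codes of relative distance `1/64`. -/
lemma exists_code (l : ℕ) (hl : 1 ≤ l) :
    ∃ C : Finset (Fin (64 * l) → ZMod 2), C.Nonempty ∧
      (∀ x ∈ C, ∀ y ∈ C, x ≠ y → l ≤ hammingDist x y) ∧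
      (2 : ℝ) ^ (64 * l) ≤ #C * 256 ^ l := by
  classical
  -- A largest code with the required distance has balls of radius below `l` that cover the cube,
  -- since an uncovered point could be added.
  let S : Finset (Finset (Fin (64 * l) → ZMod 2)) :=
    univ.filter fun C => ∀ x ∈ C, ∀ y ∈ C, x ≠ y → l ≤ hammingDist x y
  obtain ⟨C, hC, hmax⟩ := S.exists_max_image Finset.card ⟨∅, by simp [S]⟩
  have hC' := (mem_filter.1 hC).2
  have hcover : ∀ x, ∃ c ∈ C, hammingDist c x < l := by
    intro x
    by_contra! h
    have hx : x ∉ C := fun hx => by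
      have := h x hx
      simp at this
      omega
    have : insert x C ∈ S := by
      refine mem_filter.2 ⟨mem_univ _, ?_⟩
      intro a ha b hb hab
      rcases mem_insert.1 ha with rfl | ha' <;> rcases mem_insert.1 hb with rfl | hb'
      · exact absurd rfl hab
      · rw [hammingDist_comm]; exact h b hb'
      · exact h a ha'
      · exact hC' a ha' b hb' hab
    have := hmax _ this
    rw [card_insert_of_notMem hx] at this
    omega
  refine ⟨C, ?_, hC', ?_⟩
  · obtain ⟨c, hc, -⟩ := hcover 0
    exact ⟨c, hc⟩
  · have hsub : (univ : Finset (Fin (64 * l) → ZMod 2)) ⊆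
        C.biUnion fun c => {y | hammingDist c y < l} := by
      intro x _
      obtain ⟨c, hc, h⟩ := hcover x
      simp only [mem_biUnion, mem_filter, mem_univ, true_and]
      exact ⟨c, hc, h⟩
    have h1 := (card_le_card hsub).trans card_biUnion_le
    have h2 : (2 : ℝ) ^ (64 * l) ≤
        ∑ c ∈ C, (#{y : Fin (64 * l) → ZMod 2 | hammingDist c y < l} : ℝ) := by
      have hcard : #(univ : Finset (Fin (64 * l) → ZMod 2)) = 2 ^ (64 * l) := by simp [ZMod.card]
      rw [hcard] at h1
      exact_mod_cast h1
    refine h2.trans ((Finset.sum_le_sum fun c _ => card_hammingBall_le _ l c).trans ?_)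
    rw [sum_const, nsmul_eq_mul]
    gcongr
    rw [pow_mul, ← mul_pow]
    gcongr
    norm_num

/-! ### Block parities -/

section Blocks

variable {n : ℕ} {I : Type*}

/-- Flips the representative `p i` of each block `i` with `x i = 1`. -/
def flipReps (β : Fin n → I) (p : I → Fin n) (x : I → ZMod 2) (y : Fin n → Bool) : Fin n → Bool :=
  fun j => xor (y j) (decide (j = p (β j) ∧ x (β j) = 1))

lemma flipReps_involutive (β : Fin n → I) (p : I → Fin n) (x : I → ZMod 2) :
    Function.Involutive (flipReps β p x) := by
  intro y
  funext j
  simp [flipReps]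

variable [DecidableEq I]

/-- The parities of the blocks of coordinates `β ⁻¹ {i}`. -/
def blockSum (β : Fin n → I) (y : Fin n → Bool) : I → ZMod 2 :=
  fun i => ∑ j with β j = i, if y j then 1 else 0

lemma dependsOn_comp_blockSum (β : Fin n → I) {G : (I → ZMod 2) → Bool} {A : Finset I}
    (hG : DependsOn G (A : Set I)) :
    DependsOn (G ∘ blockSum β) (({j | β j ∈ A} : Finset (Fin n)) : Set (Fin n)) := by
  intro y y' h
  refine hG fun i hi => ?_
  refine Finset.sum_congr rfl fun j hj => ?_
  rw [mem_filter] at hj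
  rw [h j (by simpa [hj.2] using hi)]

lemma card_blocks (β : Fin n → I) {B : ℕ} (hβ : ∀ i, #{j | β j = i} = B) (A : Finset I) :
    #{j | β j ∈ A} = #A * B := by
  rw [Finset.card_eq_sum_card_fiberwise (f := β) (t := A) (by intro j; simp)]
  rw [← smul_eq_mul, ← Finset.sum_const]
  refine Finset.sum_congr rfl fun i hi => ?_
  rw [← hβ i, Finset.filter_filter]
  congr 1
  ext j
  simp only [mem_filter, mem_univ, true_and]
  exact ⟨fun h => h.2, fun h => ⟨h ▸ hi, h⟩⟩

lemma blockSum_flipReps (β : Fin n → I) {p : I → Fin n} (hp : ∀ i, β (p i) = i)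
    (x : I → ZMod 2) (y : Fin n → Bool) :
    blockSum β (flipReps β p x y) = blockSum β y + x := by
  funext i
  have key : ∀ (b : Bool) (P : Prop) [Decidable P] (z : ZMod 2),
      (if xor b (decide (P ∧ z = 1)) = true then (1 : ZMod 2) else 0) =
        (if b = true then 1 else 0) + if P then z else 0 := by
    intro b P _ z
    by_cases hP : P
    · simp only [hP, true_and, if_true]
      revert b z; decide
    · simp [hP]
  have hflip : ∀ j, (if flipReps β p x y j = true then (1 : ZMod 2) else 0) =
      (if y j = true then 1 else 0) + if j = p (β j) then x (β j) else 0 :=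
    fun j => key (y j) _ _
  simp only [blockSum, hflip, Pi.add_apply]
  rw [Finset.sum_add_distrib]
  congr 1
  rw [Finset.sum_eq_single (p i)]
  · simp [hp]
  · intro j hj hne
    rw [mem_filter] at hj
    rw [hj.2, if_neg hne]
  · intro h
    simp [hp] at h

variable [Fintype I]

/-- A uniform point may be resampled by flipping representatives, because each flip pattern permutes
the cube. When the representatives lie in their own blocks this makes the block parities uniform
while all other coordinates stay fixed. -/
lemma sum_card_flipReps (β : Fin n → I) (p : I → Fin n) (P : (Fin n → Bool) → Prop)
    [DecidablePred P] :
    ∑ y, #{x : I → ZMod 2 | P (flipReps β p x y)} = 2 ^ Fintype.card I * #{y | P y} := by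
  simp only [Finset.card_filter]
  rw [Finset.sum_comm]
  have : ∀ x : I → ZMod 2, ∑ y, (if P (flipReps β p x y) then 1 else 0) =
      ∑ y, if P y then 1 else 0 := fun x =>
    Equiv.sum_comp ((flipReps_involutive β p x).toPerm _) fun y => if P y then 1 else 0
  simp [this, ZMod.card]

/-- Block parities of a uniformly random point are uniformly distributed. -/
lemma card_blockSum (β : Fin n → I) {p : I → Fin n} (hp : ∀ i, β (p i) = i)
    (P : (I → ZMod 2) → Prop) [DecidablePred P] :
    2 ^ Fintype.card I * #{y | P (blockSum β y)} = 2 ^ n * #{x | P x} := by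
  rw [← sum_card_flipReps β p fun y => P (blockSum β y)]
  have : ∀ y, #{x | P (blockSum β (flipReps β p x y))} = #{x | P x} := by
    intro y
    simp only [blockSum_flipReps β hp]
    exact Finset.card_bijective _ (Equiv.addLeft (blockSum β y)).bijective (by simp)
  simp [this]

/-- A set of fewer than `(|I| - m + 1) B` coordinates misses a point of at least `m` blocks. -/
lemma exists_missed_blocks (β : Fin n → I) {B : ℕ} (hB : 1 ≤ B)
    (hβ : ∀ i, #{j | β j = i} = B) {m : ℕ} (hm : m ≤ Fintype.card I) (S : Finset (Fin n))
    (hS : #S < (Fintype.card I - m + 1) * B) :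
    ∃ (M : Finset I) (p : I → Fin n), #M = m ∧ (∀ i, β (p i) = i) ∧ ∀ i ∈ M, p i ∉ S := by
  classical
  let A : Finset I := {i | ∀ j, β j = i → j ∈ S}
  have hA : #A * B ≤ #S := by
    rw [← card_blocks β hβ]
    refine card_le_card fun j hj => ?_
    simp only [A, mem_filter, mem_univ, true_and] at hj
    exact hj j rfl
  -- `A` collects the blocks lying wholly inside `S`; at most `|I| - m` of them fit, which leaves
  -- `m` others.
  have hA' : #A < Fintype.card I - m + 1 := lt_of_mul_lt_mul_right (hA.trans_lt hS) (Nat.zero_le _)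
  obtain ⟨M, hM, hMm⟩ := Finset.exists_subset_card_eq (s := Aᶜ) (n := m)
    (by rw [card_compl]; omega)
  have hex : ∀ i, ∃ j, β j = i ∧ (i ∈ M → j ∉ S) := by
    intro i
    by_cases hi : i ∈ M
    · have := mem_compl.1 (hM hi)
      simp only [A, mem_filter, mem_univ, true_and, not_forall] at this
      obtain ⟨j, hj, hjS⟩ := this
      exact ⟨j, hj, fun _ => hjS⟩
    · have : 0 < #{j | β j = i} := by rw [hβ]; omega
      obtain ⟨j, hj⟩ := card_pos.1 this
      exact ⟨j, (mem_filter.1 hj).2, fun h => absurd h hi⟩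
  choose p hp hpS using hex
  exact ⟨M, p, hMm, hp, hpS⟩

/-- If `F` is far on `W` from every function that ignores `m` coordinates, then `F` of the block
parities, cut off outside `W`, is far from juntas. -/
lemma far_of_forall_far (β : Fin n → I) {B : ℕ} (hB : 1 ≤ B) (hβ : ∀ i, #{j | β j = i} = B)
    {m k' : ℕ} (hm : m ≤ Fintype.card I) (hk' : k' < (Fintype.card I - m + 1) * B)
    (W : Finset (I → ZMod 2)) (F : (I → ZMod 2) → Bool) {ε : ℝ}
    (hF : ∀ M : Finset I, #M = m → ∀ H : (I → ZMod 2) → Bool, DependsOn H ((M : Set I)ᶜ) →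
      ε * 2 ^ Fintype.card I < #{x ∈ W | F x ≠ H x}) :
    FarFromJuntas k' ε fun y : Fin n → Bool => decide (blockSum β y ∈ W) && F (blockSum β y) := by
  rintro g ⟨S, hS, hg⟩ hclose
  obtain ⟨M, p, hM, hp, hpS⟩ := exists_missed_blocks β hB hβ hm S (hS.trans_lt hk')
  set f : BoolFun n := fun y => decide (blockSum β y ∈ W) && F (blockSum β y) with hf
  have hy : ∀ y : Fin n → Bool, ε * 2 ^ Fintype.card I <
      (#{x : I → ZMod 2 | f (flipReps β p x y) ≠ g (flipReps β p x y)} : ℝ) := by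
    intro y
    -- With the other coordinates frozen as in `y`, this is `g` as a function of the block parities.
    -- It ignores `M` because the representatives there lie outside the junta's set `S`.
    let H : (I → ZMod 2) → Bool := fun x => g (flipReps β p (x - blockSum β y) y)
    have hH : DependsOn H ((M : Set I)ᶜ) := by
      intro x x' h
      refine hg fun j hj => ?_
      simp only [flipReps, Pi.sub_apply]
      by_cases hj' : j = p (β j)
      · have : x (β j) = x' (β j) := h _ fun hM => hpS _ hM (hj' ▸ hj)
        simp only [this]
      · simp [hj']
    refine (hF M hM H hH).trans_le ?_
    norm_cast
    refine Finset.card_le_card_of_injOn (fun x => x - blockSum β y) ?_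
      (sub_left_injective.injOn)
    intro x hx
    simp only [coe_filter, Set.mem_ofPred_eq, mem_univ, true_and] at hx ⊢
    rw [hf]
    simp only [blockSum_flipReps β hp, add_sub_cancel, hx.1, decide_true, Bool.true_and]
    exact hx.2
  have hsum := sum_card_flipReps β p (fun y => f y ≠ g y)
  have hlt : ∑ _y : Fin n → Bool, ε * 2 ^ Fintype.card I <
      ∑ y, (#{x : I → ZMod 2 | f (flipReps β p x y) ≠ g (flipReps β p x y)} : ℝ) :=
    Finset.sum_lt_sum_of_nonempty univ_nonempty fun y _ => hy y
  have hsum' : ∑ y, (#{x : I → ZMod 2 | f (flipReps β p x y) ≠ g (flipReps β p x y)} : ℝ) =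
      2 ^ Fintype.card I * #{y | f y ≠ g y} := by exact_mod_cast hsum
  rw [hsum', sum_const, card_univ, nsmul_eq_mul] at hlt
  simp only [Fintype.card_fun, Fintype.card_bool, Fintype.card_fin] at hlt
  push_cast at hlt
  have h2 : (0 : ℝ) < 2 ^ Fintype.card I := by positivity
  have : ε * 2 ^ n < #{y | f y ≠ g y} := by
    refine lt_of_mul_lt_mul_left (a := (2 : ℝ) ^ Fintype.card I) ?_ h2.le
    linarith
  exact absurd hclose (not_le.2 this)

lemma closeToJunta_blockSum (β : Fin n → I) {B : ℕ} (hB : 1 ≤ B)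
    (hβ : ∀ i, #{j | β j = i} = B) (F G : (I → ZMod 2) → Bool) {A : Finset I}
    (hG : DependsOn G (A : Set I)) {k : ℕ} (hk : #A * B ≤ k) {ε : ℝ}
    (hFG : (#{x | F x ≠ G x} : ℝ) ≤ ε * 2 ^ Fintype.card I) :
    CloseToJunta k ε fun y : Fin n → Bool => F (blockSum β y) := by
  have hex : ∀ i, ∃ j, β j = i := by
    intro i
    have : 0 < #{j | β j = i} := by rw [hβ]; omega
    obtain ⟨j, hj⟩ := card_pos.1 this
    exact ⟨j, (mem_filter.1 hj).2⟩
  choose p hp using hex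
  refine ⟨G ∘ blockSum β, ⟨_, ?_, dependsOn_comp_blockSum β hG⟩, ?_⟩
  · rwa [card_blocks β hβ]
  · have h := card_blockSum β hp (fun x => F x ≠ G x)
    have h' : (2 : ℝ) ^ Fintype.card I * #{y | F (blockSum β y) ≠ G (blockSum β y)} =
      2 ^ n * #{x | F x ≠ G x} := by exact_mod_cast h
    have h2 : (0 : ℝ) < 2 ^ Fintype.card I := by positivity
    refine le_of_mul_le_mul_left (a := (2 : ℝ) ^ Fintype.card I) ?_ h2
    simp only [Function.comp_apply]
    rw [h']
    calc (2 : ℝ) ^ n * #{x | F x ≠ G x} ≤ 2 ^ n * (ε * 2 ^ Fintype.card I) := by gcongr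
      _ = _ := by ring

lemma exists_blocks (I : Type*) [Fintype I] [DecidableEq I] (B : ℕ) :
    ∃ (n : ℕ) (β : Fin n → I), ∀ i, #{j | β j = i} = B := by
  let E := (Fintype.equivFin (I × Fin B)).symm
  refine ⟨_, fun j => (E j).1, fun i => ?_⟩
  have h := Finset.card_bijective (s := {j | (E j).1 = i}) (t := ({i} : Finset I) ×ˢ univ)
    E E.bijective (by intro j; simp only [mem_filter, mem_univ, true_and, mem_product, mem_singleton,
      and_true])
  rw [h]
  simp

end Blocks

/-! ### Planting a code in hidden blocks -/

/-- Restriction to some of the coordinates equidistributes on sets that do not depend on them. -/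
lemma card_restrict {I J : Type*} [Fintype I] [DecidableEq I] [Fintype J] [DecidableEq J]
    (u : J → I) (hu : Function.Injective u) (W : Finset (I → ZMod 2))
    (hW : DependsOn (· ∈ W) (Set.range u)ᶜ) (C : Finset (J → ZMod 2)) :
    2 ^ Fintype.card J * #{x ∈ W | x ∘ u ∈ C} = #C * #W := by
  let τ : (J → ZMod 2) → (I → ZMod 2) := fun d => Function.extend u d 0
  have hτu : ∀ d, τ d ∘ u = d := fun d => funext fun j => hu.extend_apply d 0 j
  have hτW : ∀ d x, (x + τ d ∈ W) = (x ∈ W) := fun d x => hW fun i hi => by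
    have : τ d i = 0 := Function.extend_apply' _ _ _ (by simpa using hi)
    simp [this]
  have h1 : ∀ d, #{x ∈ W | (x + τ d) ∘ u ∈ C} = #{x ∈ W | x ∘ u ∈ C} := fun d =>
    Finset.card_bijective _ (Equiv.addRight (τ d)).bijective (by simp [hτW])
  have h2 : ∀ x : I → ZMod 2, #{d | (x + τ d) ∘ u ∈ C} = #C := fun x =>
    Finset.card_bijective _ (Equiv.addLeft (x ∘ u)).bijective (by
      intro d
      have : (x + τ d) ∘ u = x ∘ u + d := by
        conv_rhs => rw [← hτu d]
        rfl
      simp [this])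
  -- Double counting over translations along the coordinates `u`, which preserve `W`.
  have h3 : ∑ d : J → ZMod 2, #{x ∈ W | (x + τ d) ∘ u ∈ C} =
      ∑ x ∈ W, #{d | (x + τ d) ∘ u ∈ C} := by
    simp only [Finset.card_filter]
    exact Finset.sum_comm
  simp only [h1, h2, sum_const, card_univ, smul_eq_mul, Fintype.card_fun, ZMod.card] at h3
  rw [h3, mul_comm]

/-- If `r` maps `U` off `U`, then the values of a random function `F` at `x ∈ U` and at `r x` rarely
differ for noticeably more than half of `U`. -/
lemma card_many_changes_le {X : Type*} [Fintype X] [DecidableEq X] (U : Finset X) (r : X → X)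
    (hr : ∀ x ∈ U, r x ∉ U) {a K : ℝ} (ha : 0 < a) (hK : 0 < K) (hU : (#U : ℝ) ≤ K) :
    (#{F : X → Bool | (#U / 2 + a : ℝ) ≤ #{x ∈ U | F x ≠ F (r x)}} : ℝ) ≤
      2 ^ Fintype.card X * Real.exp (-(2 * a ^ 2 / K)) := by
  refine le_trans (le_of_eq ?_) (card_few_disagreements_le U (fun _ => true) ha hK hU)
  -- Since `r x ∉ U`, the value `F (r x)` is untouched and `Φ` is an involution. It turns changes
  -- along `r` into values `true` on `U`, to which the Chernoff bound applies.
  let Φ : (X → Bool) → X → Bool := fun F x => if x ∈ U then xor (F x) (F (r x)) else F x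
  have hΦ : Function.Involutive Φ := by
    intro F
    funext x
    by_cases hx : x ∈ U
    · simp [Φ, hx, hr x hx]
    · simp [Φ, hx]
  norm_cast
  refine Finset.card_bijective Φ hΦ.bijective fun F => ?_
  simp only [mem_filter, mem_univ, true_and]
  have h1 := Finset.card_filter_add_card_filter_not (s := U) (fun x => F x ≠ F (r x))
  have h2 : #{x ∈ U | Φ F x ≠ true} = #{x ∈ U | ¬ F x ≠ F (r x)} := by
    congr 1
    refine Finset.filter_congr fun x hx => ?_
    simp only [Φ, hx, if_true]
    cases F x <;> cases F (r x) <;> simp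
  rw [h2]
  have h1' : (#{x ∈ U | F x ≠ F (r x)} : ℝ) + #{x ∈ U | ¬ F x ≠ F (r x)} = #U := by
    exact_mod_cast h1
  constructor <;> intro h <;> linarith

section Plant

variable {s t v : ℕ}

/-- The blocks: `s` control blocks, and a `t × v` array of action blocks, from every row of which
one block will be hidden. -/
abbrev Blocks (s t v : ℕ) : Type := Fin s ⊕ (Fin t × Fin v)

/-- The coordinates of `x` at the hidden blocks. -/
def hiddenPart (e : Fin t → Fin v) (x : Blocks s t v → ZMod 2) : Fin t → ZMod 2 :=
  x ∘ fun j => Sum.inr (j, e j)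

/-- Overwrites the coordinates at the hidden blocks by `c`. -/
def plant (e : Fin t → Fin v) (c : Fin t → ZMod 2) (x : Blocks s t v → ZMod 2) :
    Blocks s t v → ZMod 2 :=
  Sum.elim (fun a => x (Sum.inl a)) fun p => if p.2 = e p.1 then c p.1 else x (Sum.inr p)

/-- The points whose control part lies in `R`. -/
def active (t v : ℕ) (R : Finset (Fin s → ZMod 2)) : Finset (Blocks s t v → ZMod 2) :=
  {x | x ∘ Sum.inl ∈ R}

lemma mem_active {R : Finset (Fin s → ZMod 2)} {x : Blocks s t v → ZMod 2} :
    x ∈ active t v R ↔ x ∘ Sum.inl ∈ R := by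
  simp [active]

/-- Identifies the active points that agree off the hidden blocks and have codewords there. -/
def collapse (R : Finset (Fin s → ZMod 2)) (C : Finset (Fin t → ZMod 2)) (c : Fin t → ZMod 2)
    (e : Fin t → Fin v) (x : Blocks s t v → ZMod 2) : Blocks s t v → ZMod 2 :=
  if x ∈ active t v R ∧ hiddenPart e x ∈ C then plant e c x else x

lemma hiddenPart_plant (e : Fin t → Fin v) (c : Fin t → ZMod 2) (x : Blocks s t v → ZMod 2) :
    hiddenPart e (plant e c x) = c := by
  funext j
  simp [hiddenPart, plant]

lemma plant_mem_active {R : Finset (Fin s → ZMod 2)} (e : Fin t → Fin v) (c : Fin t → ZMod 2)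
    (x : Blocks s t v → ZMod 2) : plant e c x ∈ active t v R ↔ x ∈ active t v R := by
  rw [mem_active, mem_active]
  rfl

lemma apply_eq_of_plant_eq {e : Fin t → Fin v} {c : Fin t → ZMod 2}
    {x x' : Blocks s t v → ZMod 2} (h : plant e c x = plant e c x') :
    (∀ a, x (Sum.inl a) = x' (Sum.inl a)) ∧
      ∀ p : Fin t × Fin v, p.2 ≠ e p.1 → x (Sum.inr p) = x' (Sum.inr p) := by
  refine ⟨fun a => congrFun h (Sum.inl a), fun p hp => ?_⟩
  simpa [plant, hp] using congrFun h (Sum.inr p)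

/-- As `c ∈ C`, an overwritten point is again active with a codeword in the hidden part. It
therefore cannot coincide with a point that escapes overwriting. -/
lemma collapse_eq_collapse {R : Finset (Fin s → ZMod 2)} {C : Finset (Fin t → ZMod 2)}
    {c : Fin t → ZMod 2} (hc : c ∈ C) {e : Fin t → Fin v} {x x' : Blocks s t v → ZMod 2}
    (hx : x ≠ x') (h : collapse R C c e x = collapse R C c e x') :
    hiddenPart e x ∈ C ∧ hiddenPart e x' ∈ C ∧ plant e c x = plant e c x' := by
  have key : ∀ {z w : Blocks s t v → ZMod 2}, z ∈ active t v R → plant e c z = w →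
      w ∈ active t v R ∧ hiddenPart e w ∈ C := by
    rintro z w hz rfl
    exact ⟨(plant_mem_active _ _ _).2 hz, by rwa [hiddenPart_plant]⟩
  unfold collapse at h
  split_ifs at h with h1 h2 h2
  · exact ⟨h1.2, h2.2, h⟩
  · exact absurd (key h1.1 h) h2
  · exact absurd (key h2.1 h.symm) h1
  · exact absurd h hx

/-- Two distinct points are rarely identified by the choice of the hidden blocks. -/
lemma card_collapse_eq_le {R : Finset (Fin s → ZMod 2)} {C : Finset (Fin t → ZMod 2)} {l : ℕ}
    (hC : ∀ y ∈ C, ∀ y' ∈ C, y ≠ y' → l ≤ hammingDist y y') {c : Fin t → ZMod 2} (hc : c ∈ C)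
    (hv : 1 ≤ v) (x x' : Blocks s t v → ZMod 2) (hx : x ≠ x') :
    #{e : Fin t → Fin v | collapse R C c e x = collapse R C c e x'} ≤ v ^ (t - l) := by
  by_cases hex : ∃ e : Fin t → Fin v, collapse R C c e x = collapse R C c e x'
  swap
  · push Not at hex
    simp [hex]
  obtain ⟨e, he⟩ := hex
  obtain ⟨h1, h2, h3⟩ := collapse_eq_collapse hc hx he
  have h4 := apply_eq_of_plant_eq h3
  have hne : hiddenPart e x ≠ hiddenPart e x' := by
    intro heq
    refine hx (funext fun i => ?_)
    rcases i with a | ⟨j, b⟩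
    · exact h4.1 a
    · by_cases hb : b = e j
      · subst hb; exact congrFun heq j
      · exact h4.2 (j, b) hb
  have hl := hC _ h1 _ h2 hne
  -- The points differ at `(j, e j)` for `j ∈ J`, while a colliding choice `e'` requires agreement
  -- off its own hidden blocks. This forces `e' j = e j` on all of `J`.
  let J : Finset (Fin t) := {j | hiddenPart e x j ≠ hiddenPart e x' j}
  have hJ : l ≤ #J := hl
  have hsub : ({e' : Fin t → Fin v | collapse R C c e' x = collapse R C c e' x'} : Finset _) ⊆
      Fintype.piFinset fun j => if j ∈ J then {e j} else univ := by
    intro e' he'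
    have h5 := apply_eq_of_plant_eq (collapse_eq_collapse hc hx (mem_filter.1 he').2).2.2
    rw [Fintype.mem_piFinset]
    intro j
    split_ifs with hj
    · rw [mem_singleton]
      by_contra hne'
      exact (mem_filter.1 hj).2 (h5.2 (j, e j) (Ne.symm hne'))
    · exact mem_univ _
  refine (card_le_card hsub).trans ?_
  rw [Fintype.card_piFinset]
  have : ∀ j, #(if j ∈ J then {e j} else (univ : Finset (Fin v))) = if j ∈ J then 1 else v := by
    intro j; split_ifs <;> simp
  simp only [this]
  rw [Finset.prod_ite]
  simp only [prod_const_one, one_mul, prod_const]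
  refine Nat.pow_le_pow_right hv ?_
  have := Finset.card_filter_add_card_filter_not (s := (univ : Finset (Fin t))) (· ∈ J)
  rw [Finset.filter_mem_eq_inter, univ_inter, card_univ, Fintype.card_fin] at this
  omega

lemma card_active (t v : ℕ) (R : Finset (Fin s → ZMod 2)) :
    2 ^ s * #(active t v R) = #R * 2 ^ (s + t * v) := by
  have h := card_restrict (Sum.inl : Fin s → Blocks s t v) Sum.inl_injective univ
    (fun _ _ _ => by simp) R
  simpa [active, ZMod.card] using h

lemma card_active_hiddenPart (R : Finset (Fin s → ZMod 2)) (C : Finset (Fin t → ZMod 2))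
    (e : Fin t → Fin v) :
    2 ^ t * #{x ∈ active t v R | hiddenPart e x ∈ C} = #C * #(active t v R) := by
  have h := card_restrict (fun j => (Sum.inr (j, e j) : Blocks s t v))
    (fun j j' h => by simpa using (Prod.ext_iff.1 (Sum.inr.inj h)).1) (active t v R)
    (fun x y h => by
      have : x ∘ Sum.inl = y ∘ Sum.inl := funext fun a => h _ (by simp)
      simp only [mem_active, this]) C
  rw [Fintype.card_fin] at h
  exact h

lemma dependsOn_plant (R : Finset (Fin s → ZMod 2)) (c : Fin t → ZMod 2) (e : Fin t → Fin v)
    (F : (Blocks s t v → ZMod 2) → Bool) :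
    DependsOn (fun x => decide (x ∈ active t v R) && F (plant e c x))
      (((univ.image fun j => (Sum.inr (j, e j) : Blocks s t v))ᶜ :
        Finset (Blocks s t v)) : Set (Blocks s t v)) := by
  intro x y h
  have h1 : x ∘ Sum.inl = y ∘ Sum.inl := funext fun a => h _ (by simp)
  have h2 : plant e c x = plant e c y := by
    funext i
    rcases i with a | ⟨j, b⟩
    · exact congrFun h1 a
    · by_cases hb : b = e j
      · simp [plant, hb]
      · simp only [plant, Sum.elim_inr, hb, if_false]
        refine h _ ?_
        simp only [coe_compl, coe_image, coe_univ, Set.image_univ, Set.mem_compl_iff,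
          Set.mem_range, not_exists]
        rintro j' hj'
        obtain ⟨rfl, rfl⟩ := Prod.ext_iff.1 (Sum.inr.inj hj')
        exact hb rfl
  simp only [mem_active, h1, h2]

lemma card_compl_hidden (e : Fin t → Fin v) :
    #((univ.image fun j => (Sum.inr (j, e j) : Blocks s t v))ᶜ) = s + t * v - t := by
  rw [card_compl, card_image_of_injective _
    (fun j j' h => by simpa using (Prod.ext_iff.1 (Sum.inr.inj h)).1)]
  simp

/-- Observes only the table entries of points whose block parities lie in `W`. -/
def gate {n : ℕ} (β : Fin n → Blocks s t v) (W : Finset (Blocks s t v → ZMod 2))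
    (y : Fin n → Bool) (b : Bool) : Bool :=
  decide (blockSum β y ∈ W) && b

lemma card_filter_prod {A B : Type*} [Fintype A] [Fintype B] (P : A → B → Prop)
    [∀ a b, Decidable (P a b)] : #{ω : A × B | P ω.1 ω.2} = ∑ a, #{b | P a b} := by
  simp only [Finset.card_filter]
  rw [Fintype.sum_prod_type]

lemma sum_card_filter_comm {A B : Type*} [Fintype A] [Fintype B] (P : A → B → Prop)
    [∀ a b, Decidable (P a b)] : ∑ a, #{b | P a b} = ∑ b, #{a | P a b} := by
  simp only [Finset.card_filter]
  exact Finset.sum_comm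

lemma mul_card_filter_prod_le {A B : Type*} [Fintype A] [Fintype B] (P : A → B → Prop)
    [∀ a b, Decidable (P a b)] {c K : ℕ} (h : ∀ a, c * #{b | P a b} ≤ K) :
    c * #{ω : A × B | P ω.1 ω.2} ≤ Fintype.card A * K := by
  rw [card_filter_prod, Finset.mul_sum]
  simpa using Finset.sum_le_card_nsmul univ _ _ fun a _ => h a

/-- In the unplanted model the queries for a fixed table do not depend on the hidden blocks, so even
an adaptive algorithm must find a collision with a query list chosen independently of them. -/
lemma card_run_planted_le {n l q : ℕ} {R : Finset (Fin s → ZMod 2)}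
    {C : Finset (Fin t → ZMod 2)} (hC : ∀ y ∈ C, ∀ y' ∈ C, y ≠ y' → l ≤ hammingDist y y')
    {c : Fin t → ZMod 2} (hc : c ∈ C) (hv : 1 ≤ v) (β : Fin n → Blocks s t v) (a : QueryAlg n)
    (ha : ∀ f, a.numQueries f ≤ q) :
    #{ω : (Fin t → Fin v) × ((Blocks s t v → ZMod 2) → Bool) |
        a.run (lookup (blockSum β) (gate β (active t v R)) (collapse R C c ω.1) ω.2) = true} ≤
      #{ω : (Fin t → Fin v) × ((Blocks s t v → ZMod 2) → Bool) |
        a.run (lookup (blockSum β) (gate β (active t v R)) id ω.2) = true} +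
        q * q * v ^ (t - l) * Fintype.card ((Blocks s t v → ZMod 2) → Bool) := by
  classical
  set obs := gate β (active t v R)
  rw [card_filter_prod fun e F => a.run (lookup (blockSum β) obs (collapse R C c e) F) = true,
    card_filter_prod fun (_ : Fin t → Fin v) F => a.run (lookup (blockSum β) obs id F) = true]
  refine (Finset.sum_le_sum fun e _ =>
    card_run_lookup_le (blockSum β) obs (collapse R C c e) a).trans ?_
  rw [Finset.sum_add_distrib]
  refine Nat.add_le_add_left ?_ _
  rw [sum_card_filter_comm fun e F => ¬ Set.InjOn (collapse R C c e)
    (blockSum β '' {y | y ∈ a.queries (lookup (blockSum β) obs id F)})]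
  refine (Finset.sum_le_card_nsmul _ _ (q * q * v ^ (t - l)) fun F _ => ?_).trans ?_
  · exact card_not_injOn_le (collapse R C c) _ (card_collapse_eq_le hC hc hv) (blockSum β)
      (a.queries (lookup (blockSum β) obs id F)) q ((QueryAlg.length_queries _ _).trans_le (ha _))
  · rw [card_univ, smul_eq_mul, mul_comm]

lemma card_active_eq (R : Finset (Fin s → ZMod 2)) :
    (#(active t v R) : ℝ) = #R / 2 ^ s * 2 ^ (s + t * v) := by
  have : (2 : ℝ) ^ s * #(active t v R) = #R * 2 ^ (s + t * v) := by
    exact_mod_cast card_active t v R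
  field_simp
  linarith

lemma card_active_notMem_eq (R : Finset (Fin s → ZMod 2)) (C : Finset (Fin t → ZMod 2))
    (e : Fin t → Fin v) :
    (#{x ∈ active t v R | ¬ hiddenPart e x ∈ C} : ℝ) =
      #R / 2 ^ s * (1 - #C / 2 ^ t) * 2 ^ (s + t * v) := by
  have h1 := Finset.card_filter_add_card_filter_not (s := active t v R)
    (fun x => hiddenPart e x ∈ C)
  have h1' : (#{x ∈ active t v R | hiddenPart e x ∈ C} : ℝ) +
    #{x ∈ active t v R | ¬ hiddenPart e x ∈ C} = #(active t v R) := by exact_mod_cast h1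
  have h2 : (2 : ℝ) ^ t * #{x ∈ active t v R | hiddenPart e x ∈ C} = #C * #(active t v R) := by
    exact_mod_cast card_active_hiddenPart R C e
  have h3 : (#{x ∈ active t v R | hiddenPart e x ∈ C} : ℝ) = #C / 2 ^ t * #(active t v R) := by
    field_simp; linarith
  rw [h3] at h1'
  rw [mul_right_comm, ← card_active_eq]
  linarith

lemma card_points : Fintype.card (Blocks s t v → ZMod 2) = 2 ^ (s + t * v) := by
  simp [ZMod.card]

open Classical in
/-- The planted functions are mostly close to juntas. -/
lemma card_planted_not_close_le {n m B k : ℕ} {ε τ : ℝ} {R : Finset (Fin s → ZMod 2)}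
    {C : Finset (Fin t → ZMod 2)} {c : Fin t → ZMod 2} (hc : c ∈ C) (β : Fin n → Blocks s t v)
    (hB : 1 ≤ B) (hβ : ∀ i, #{j | β j = i} = B) (hk : (s + t * v - t) * B ≤ k)
    (hm : m ≤ s + t * v) (hτ : 0 < τ) (hτm : 8 ≤ τ ^ 2 * 2 ^ m)
    (hε : (#R : ℝ) / 2 ^ s * (1 - #C / 2 ^ t) / 2 + τ ≤ ε) (e : Fin t → Fin v) :
    16 * #{F | ¬ CloseToJunta k ε
        (lookup (blockSum β) (gate β (active t v R)) (collapse R C c e) F)} ≤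
      Fintype.card ((Blocks s t v → ZMod 2) → Bool) := by
  set U : Finset (Blocks s t v → ZMod 2) := {x ∈ active t v R | ¬ hiddenPart e x ∈ C} with hUdef
  have hU : (#U : ℝ) = #R / 2 ^ s * (1 - #C / 2 ^ t) * 2 ^ (s + t * v) :=
    card_active_notMem_eq R C e
  have hUN : (#U : ℝ) ≤ 2 ^ (s + t * v) := by
    have := Finset.card_le_univ U
    rw [card_points] at this
    exact_mod_cast this
  have hbad := card_many_changes_le U (plant e c) (fun x hx hx' => by
      have := (mem_filter.1 hx').2
      rw [hiddenPart_plant] at this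
      exact this hc) (a := τ * 2 ^ (s + t * v)) (K := 2 ^ (s + t * v)) (by positivity)
      (by positivity) hUN
  have hsub : #{F | ¬ CloseToJunta k ε
        (lookup (blockSum β) (gate β (active t v R)) (collapse R C c e) F)} ≤
      #{F : (Blocks s t v → ZMod 2) → Bool |
        (#U / 2 + τ * 2 ^ (s + t * v) : ℝ) ≤ #{x ∈ U | F x ≠ F (plant e c x)}} := by
    refine card_le_card fun F hF => ?_
    rw [mem_filter] at hF ⊢
    refine ⟨mem_univ _, ?_⟩
    by_contra! hlt
    refine hF.2 ?_
    refine closeToJunta_blockSum β hB hβ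
      (fun x => decide (x ∈ active t v R) && F (collapse R C c e x)) _
      (dependsOn_plant R c e F) (k := k) ?_ ?_
    · rw [card_compl_hidden]; exact hk
    -- On codewords `collapse` and `plant` agree, so only active points of `U` can contribute.
    · have hset : ({x | (decide (x ∈ active t v R) && F (collapse R C c e x)) ≠
          (decide (x ∈ active t v R) && F (plant e c x))} : Finset (Blocks s t v → ZMod 2)) =
          {x ∈ U | F x ≠ F (plant e c x)} := by
        refine Finset.ext fun x => ?_
        rw [mem_filter, mem_filter, hUdef, mem_filter]
        by_cases hxW : x ∈ active t v R
        · by_cases hxC : hiddenPart e x ∈ C <;> simp [collapse, hxW, hxC]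
        · simp [hxW]
      rw [hset]
      refine hlt.le.trans ?_
      have hcard : Fintype.card (Blocks s t v) = s + t * v := by simp
      rw [hU, hcard]
      have h2 : (0 : ℝ) < 2 ^ (s + t * v) := by positivity
      nlinarith
  have hexp : Real.exp (-(2 * (τ * 2 ^ (s + t * v)) ^ 2 / 2 ^ (s + t * v))) ≤ 1 / 16 := by
    have h1 : (16 : ℝ) ≤ 2 * (τ * 2 ^ (s + t * v)) ^ 2 / 2 ^ (s + t * v) := by
      have h2 : 2 * (τ * 2 ^ (s + t * v)) ^ 2 / 2 ^ (s + t * v) =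
        2 * (τ ^ 2 * 2 ^ (s + t * v)) := by field_simp
      rw [h2]
      have h3 : τ ^ 2 * 2 ^ m ≤ τ ^ 2 * 2 ^ (s + t * v) := by gcongr; norm_num
      linarith
    have h2 : (16 : ℝ) ≤ Real.exp (2 * (τ * 2 ^ (s + t * v)) ^ 2 / 2 ^ (s + t * v)) := by
      linarith [Real.add_one_le_exp (2 * (τ * 2 ^ (s + t * v)) ^ 2 / 2 ^ (s + t * v))]
    rw [Real.exp_neg, inv_eq_one_div]
    gcongr
  have h16 : (16 : ℝ) * #{F | ¬ CloseToJunta k ε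
      (lookup (blockSum β) (gate β (active t v R)) (collapse R C c e) F)} ≤
      2 ^ Fintype.card (Blocks s t v → ZMod 2) := by
    have h1 : (#{F | ¬ CloseToJunta k ε
        (lookup (blockSum β) (gate β (active t v R)) (collapse R C c e) F)} : ℝ) ≤
        2 ^ Fintype.card (Blocks s t v → ZMod 2) * (1 / 16) :=
      (Nat.cast_le.2 hsub).trans (hbad.trans (by gcongr))
    linarith
  rw [Fintype.card_fun, Fintype.card_bool]
  exact_mod_cast h16

open Classical in
/-- The random functions are mostly far from juntas. -/
lemma card_random_not_far_le {n m B k' : ℕ} {ε τ : ℝ} {R : Finset (Fin s → ZMod 2)}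
    (β : Fin n → Blocks s t v) (hB : 1 ≤ B) (hβ : ∀ i, #{j | β j = i} = B)
    (hm : m ≤ s + t * v) (hk' : k' < (s + t * v - m + 1) * B)
    (hN : s + t * v ≤ 2 ^ (s + t * v - m)) (hτ : 0 < τ) (hτm : 8 ≤ τ ^ 2 * 2 ^ m)
    (hε : ε + τ ≤ (#R : ℝ) / 2 ^ s / 2) :
    16 * #{F | ¬ FarFromJuntas k' ε
        (lookup (blockSum β) (gate β (active t v R)) id F)} ≤
      Fintype.card ((Blocks s t v → ZMod 2) → Bool) := by
  have hI : Fintype.card (Blocks s t v) = s + t * v := by simp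
  have hbad := card_near_junta_le (active t v R) hτ (m := m) (by rwa [hI]) (by rwa [hI]) hτm
  refine le_trans (Nat.mul_le_mul_left 16 (card_le_card ?_)) hbad
  intro F hF
  rw [mem_filter] at hF ⊢
  refine ⟨mem_univ _, ?_⟩
  by_contra! hlt
  refine hF.2 (far_of_forall_far β hB hβ (m := m) (by rwa [hI]) (by rwa [hI]) _ F ?_)
  intro M hM H hH
  refine lt_of_le_of_lt ?_ (hlt M hM H hH)
  rw [card_active_eq, hI]
  have h2 : (0 : ℝ) < 2 ^ (s + t * v) := by positivity
  nlinarith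

end Plant

/-! ### Choice of parameters and the lower bound -/

/-- A tester cannot tell a random function of block parities from one with a planted code. -/
theorem no_tester_of_code {s t v l m B k k' q : ℕ} {ε₁ ε₂ τ : ℝ}
    (C : Finset (Fin t → ZMod 2)) (hC0 : C.Nonempty)
    (hC : ∀ y ∈ C, ∀ y' ∈ C, y ≠ y' → l ≤ hammingDist y y')
    (R : Finset (Fin s → ZMod 2)) (hB : 1 ≤ B) (hv : 1 ≤ v) (hlt : l ≤ t)
    (hk : (s + t * v - t) * B ≤ k) (hm : m ≤ s + t * v)
    (hk' : k' < (s + t * v - m + 1) * B) (hN : s + t * v ≤ 2 ^ (s + t * v - m))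
    (hτ : 0 < τ) (hτm : 8 ≤ τ ^ 2 * 2 ^ m)
    (hyes : (#R : ℝ) / 2 ^ s * (1 - #C / 2 ^ t) / 2 + τ ≤ ε₁)
    (hno : ε₂ + τ ≤ (#R : ℝ) / 2 ^ s / 2)
    (hq : 16 * (q * q) ≤ v ^ l)
    (T : RandQueryAlg) (hT : T.IsJuntaTester k k' ε₁ ε₂) (hTq : T.MakesAtMost q) : False := by
  classical
  obtain ⟨c, hc⟩ := hC0
  obtain ⟨n, β, hβ⟩ := exists_blocks (Blocks s t v) B
  have hΩ : Fintype.card ((Fin t → Fin v) × ((Blocks s t v → ZMod 2) → Bool)) =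
      v ^ t * Fintype.card ((Blocks s t v → ZMod 2) → Bool) := by
    rw [Fintype.card_prod, Fintype.card_fun, Fintype.card_fin, Fintype.card_fin]
  have : Nonempty (Fin t → Fin v) := ⟨fun _ => ⟨0, hv⟩⟩
  refine false_of_indistinguishable (T n)
    (fun ω : (Fin t → Fin v) × ((Blocks s t v → ZMod 2) → Bool) =>
      lookup (blockSum β) (gate β (active t v R)) (collapse R C c ω.1) ω.2)
    (fun ω => lookup (blockSum β) (gate β (active t v R)) id ω.2) _ ?_
    (fun a ha => card_run_planted_le hC hc hv β a fun f => hTq n f a ha) ?_ ?_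
  · rw [hΩ]
    calc 16 * (q * q * v ^ (t - l) * Fintype.card ((Blocks s t v → ZMod 2) → Bool))
        = 16 * (q * q) * v ^ (t - l) * Fintype.card ((Blocks s t v → ZMod 2) → Bool) := by ring
      _ ≤ v ^ l * v ^ (t - l) * Fintype.card ((Blocks s t v → ZMod 2) → Bool) := by gcongr
      _ = v ^ t * Fintype.card ((Blocks s t v → ZMod 2) → Bool) := by
        rw [← pow_add]; congr 2; omega
  · rw [hΩ]
    refine le_trans (Nat.mul_le_mul_left 16 (card_le_card ?_)) ((mul_card_filter_prod_le
      (fun e F => ¬ CloseToJunta k ε₁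
        (lookup (blockSum β) (gate β (active t v R)) (collapse R C c e) F))
      fun e => card_planted_not_close_le hc β hB hβ hk hm hτ hτm hyes e).trans_eq ?_)
    · exact Finset.monotone_filter_right _ fun ω _ h hclose => h ((hT n _).1 hclose)
    · rw [Fintype.card_fun, Fintype.card_fin, Fintype.card_fin]
  · rw [hΩ]
    refine le_trans (Nat.mul_le_mul_left 16 (card_le_card ?_)) ((mul_card_filter_prod_le
      (fun (_ : Fin t → Fin v) F => ¬ FarFromJuntas k' ε₂
        (lookup (blockSum β) (gate β (active t v R)) id F))
      fun _ => card_random_not_far_le (R := R) β hB hβ hm hk' hN hτ hτm hno).trans_eq ?_)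
    · exact Finset.monotone_filter_right _ fun ω _ h hfar => h ((hT n _).2 hfar)
    · rw [Fintype.card_fun, Fintype.card_fin, Fintype.card_fin]

/-- The lower bound `16 q² > v ^ l` with explicit integer parameters. -/
theorem no_tester_of_params {l v k k' q : ℕ} {ε₁ ε₂ : ℝ} (hl : 1 ≤ l) (hv : 1 ≤ v)
    (hk : 384 * l * v ^ 2 < k) (hk' : 4 * v * k' ≤ (4 * v + 1) * k)
    (h1 : 0.01 ≤ ε₁) (h12 : ε₁ < ε₂) (h2 : ε₂ ≤ 0.49) (hgap : l = 1 ∨ 2 ≤ l ∧ ε₂ - ε₁ ≤ (1 / 2 ^ 20) ^ l)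
    (hq : 16 * (q * q) ≤ v ^ l)
    (T : RandQueryAlg) (hT : T.IsJuntaTester k k' ε₁ ε₂) (hTq : T.MakesAtMost q) : False := by
  have hlv : l ≤ l * v := Nat.le_mul_of_pos_right _ hv
  -- The parameters are `s = 16 * l`, `t = 64 * l`, `m = 32 * l`; `a` counts the blocks seen by the
  -- planted junta, and `B = k / a`.
  obtain ⟨a, ha⟩ : ∃ a, a = 16 * l + 64 * l * v - 64 * l := ⟨_, rfl⟩
  have ha0 : 0 < a := by rw [ha, mul_assoc]; omega
  have ha1 : a ≤ 64 * (l * v) := by rw [ha, mul_assoc]; omega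
  have ham : 16 * l + 64 * l * v - 32 * l = a + 32 * l := by rw [ha, mul_assoc]; omega
  have hka : a ≤ k := by nlinarith
  have hB : 1 ≤ k / a := (Nat.one_le_div_iff ha0).2 hka
  have hkB : k < a * (k / a) + a := Nat.lt_mul_div_succ k ha0 |>.trans_eq (by ring)
  have hk1 : a * (k / a) ≤ k := Nat.mul_div_le k a
  have hk2 : k' < (16 * l + 64 * l * v - 32 * l + 1) * (k / a) := by
    rw [ham]
    refine lt_of_mul_lt_mul_left (a := 4 * v) (hk'.trans_lt ?_) (Nat.zero_le _)
    generalize k / a = B at *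
    -- The extra `32 * l` blocks are at least a fraction `1 / (2 * v)` of `a`, twice the required `1
    -- / (4 * v)`. The surplus absorbs the rounding loss `k - a * B < a`, because `384 * l * v ^ 2 <
    -- k`.
    have e1 : 4 * v * ((a + 32 * l + 1) * B) =
      4 * v * (a * B) + 128 * (l * v) * B + 4 * v * B := by ring
    have e2 : 2 * (a * B) ≤ 128 * (l * v) * B := by
      have := Nat.mul_le_mul_right B ha1
      nlinarith
    have e3 : (4 * v + 2) * a ≤ 384 * l * v ^ 2 := by
      calc (4 * v + 2) * a ≤ (4 * v + 2 * v) * (64 * (l * v)) := by gcongr; omega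
        _ = _ := by ring
    have e4 : (4 * v + 2) * k ≤ (4 * v + 2) * (a * B + a) := Nat.mul_le_mul_left _ hkB.le
    nlinarith
  have hN : 16 * l + 64 * l * v ≤ 2 ^ (16 * l + 64 * l * v - 32 * l) := by
    rw [ham]
    have hx : ∀ x : ℕ, 1 ≤ x → 2 * x ≤ 2 ^ x := by
      intro x hx
      obtain ⟨y, rfl⟩ := Nat.exists_eq_add_of_le' hx
      have := Nat.lt_two_pow_self (n := y)
      rw [pow_succ]
      omega
    refine le_trans ?_ (hx _ (by omega))
    rw [ha, mul_assoc]; omega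
  -- The density scale of the code. In these terms `2 ^ (-s) = x ^ 2` is the granularity of the
  -- density of `R`, and the sampling error `τ = 4 * x ^ 2` is of the same order.
  set x : ℝ := (1 / 256) ^ l with hxdef
  have hx0 : 0 < x := by positivity
  have hx1 : x ≤ 1 / 256 :=
    (pow_le_pow_of_le_one (by norm_num) (by norm_num) hl).trans_eq (pow_one _)
  have h256 : (256 : ℝ) ^ l * x = 1 := by rw [hxdef, ← mul_pow]; norm_num
  have hs : (2 : ℝ) ^ (16 * l) * x ^ 2 = 1 := by
    rw [show 16 * l = 8 * l * 2 by ring, pow_mul, ← mul_pow, pow_mul]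
    norm_num [h256]
  have hτm : 8 ≤ (4 * x ^ 2) ^ 2 * 2 ^ (32 * l) := by
    rw [show 32 * l = 16 * l * 2 by ring, pow_mul, ← mul_pow, mul_assoc, mul_comm (x ^ 2), hs]
    norm_num
  have hm : 32 * l ≤ 16 * l + 64 * l * v := by rw [mul_assoc]; omega
  have hk0 : (16 * l + 64 * l * v - 64 * l) * (k / a) ≤ k := by rwa [← ha]
  rcases hgap with rfl | ⟨hl2, hgap⟩
  -- The full cube is a code of distance `1`. Planted functions are then exact juntas and random
  -- ones are nearly `1/2`-far, so no bound on `ε₂ - ε₁` is needed.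
  · refine no_tester_of_code (s := 16 * 1) (t := 64 * 1) (l := 1) (m := 32 * 1) (τ := 4 * x ^ 2)
      univ univ_nonempty (fun y _ y' _ h => Nat.succ_le_iff.2 (hammingDist_pos.2 h)) univ hB hv
      (by norm_num) hk0 hm hk2 hN (by positivity) hτm ?_ ?_ hq T hT hTq
    · simp only [card_univ, Fintype.card_fun, ZMod.card, Fintype.card_fin]
      push_cast
      nlinarith
    · simp only [card_univ, Fintype.card_fun, ZMod.card, Fintype.card_fin]
      push_cast
      nlinarith
  · obtain ⟨C, hC0, hC, hCcard⟩ := exists_code l hl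
    have hx2 : x ≤ 1 / 2 ^ 16 :=
      (pow_le_pow_of_le_one (by norm_num) (by norm_num) hl2).trans_eq (by norm_num)
    have hgap' : ε₂ - ε₁ ≤ x / 2 ^ 24 := by
      refine hgap.trans ?_
      have h3 : (1 / 2 ^ 20 : ℝ) ^ l = x * (1 / 2 ^ 12) ^ l := by
        rw [hxdef, ← mul_pow]; norm_num
      have h4 : (1 / 2 ^ 12 : ℝ) ^ l ≤ (1 / 2 ^ 12) ^ 2 :=
        pow_le_pow_of_le_one (by norm_num) (by norm_num) hl2
      rw [h3, div_eq_mul_inv]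
      exact mul_le_mul_of_nonneg_left (h4.trans (by norm_num)) hx0.le
    have hC1 : x ≤ #C / 2 ^ (64 * l) := by
      rw [le_div_iff₀ (by positivity)]
      calc x * 2 ^ (64 * l) ≤ x * (#C * 256 ^ l) := by gcongr
        _ = #C * (256 ^ l * x) := by ring
        _ = #C := by rw [h256, mul_one]
    have hC2 : (#C : ℝ) / 2 ^ (64 * l) ≤ 1 := by
      rw [div_le_one (by positivity)]
      have := Finset.card_le_univ C
      rw [Fintype.card_fun, ZMod.card, Fintype.card_fin] at this
      exact_mod_cast this
    have hS0 : (0 : ℝ) < 2 ^ (16 * l) := by positivity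
    have hSx : (1 : ℝ) / 2 ^ (16 * l) = x ^ 2 := by
      rw [div_eq_iff hS0.ne', mul_comm, hs]
    have hxx : x ^ 2 ≤ x / 2 ^ 16 := by nlinarith
    -- The least size of `R` for which half its density covers `ε₂ + τ`.
    set A : ℕ := ⌈2 ^ (16 * l) * (2 * (ε₂ + 4 * x ^ 2))⌉₊ with hA
    have hA1 : 2 * (ε₂ + 4 * x ^ 2) ≤ A / 2 ^ (16 * l) := by
      rw [le_div_iff₀ hS0, mul_comm]
      exact Nat.le_ceil _
    have hA2 : A / 2 ^ (16 * l) ≤ 2 * (ε₂ + 4 * x ^ 2) + x ^ 2 := by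
      have hε : 0 < ε₂ := by linarith
      have hc := (Nat.ceil_lt_add_one
        (a := (2 : ℝ) ^ (16 * l) * (2 * (ε₂ + 4 * x ^ 2))) (by positivity)).le
      rw [← hSx, div_le_iff₀ hS0, add_mul, one_div_mul_cancel hS0.ne',
        mul_comm _ ((2 : ℝ) ^ (16 * l)), hSx]
      exact hc
    have hA3 : A ≤ #(univ : Finset (Fin (16 * l) → ZMod 2)) := by
      rw [card_univ, Fintype.card_fun, ZMod.card, Fintype.card_fin]
      have : (A : ℝ) / 2 ^ (16 * l) ≤ 1 := by
        linarith
      rw [div_le_one hS0] at this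
      exact_mod_cast this
    obtain ⟨R, -, hR⟩ := Finset.exists_subset_card_eq hA3
    refine no_tester_of_code (s := 16 * l) (t := 64 * l) (l := l) (m := 32 * l) (τ := 4 * x ^ 2)
      C hC0 hC R hB hv (by omega) hk0 hm hk2 hN (by positivity) hτm ?_ ?_ hq T hT hTq
    · rw [hR]
      have h3 : (A : ℝ) / 2 ^ (16 * l) * (1 - #C / 2 ^ (64 * l)) ≤
          (2 * (ε₂ + 4 * x ^ 2) + x ^ 2) * (1 - #C / 2 ^ (64 * l)) :=
        mul_le_mul_of_nonneg_right hA2 (by linarith)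
      have h4 : (2 * (ε₂ + 4 * x ^ 2) + x ^ 2) * (1 - #C / 2 ^ (64 * l)) ≤
          (2 * (ε₂ + 4 * x ^ 2) + x ^ 2) * (1 - x) :=
        mul_le_mul_of_nonneg_left (by linarith)
          (by linarith [sq_nonneg x])
      -- Planting gains `ε₂ * x ≥ 0.01 * x`. This pays for `ε₂ - ε₁ ≤ x / 2 ^ 24` and for the `x ^
      -- 2` errors, which are small because `l ≥ 2` gives `x ≤ 2 ^ (-16)`.
      have h5 : 0.01 * x ≤ ε₂ * x := by gcongr; linarith
      have h6 : 0 < x ^ 2 * x := by positivity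
      have h7 : (2 * (ε₂ + 4 * x ^ 2) + x ^ 2) * (1 - x) =
          2 * ε₂ + 9 * x ^ 2 - 2 * (ε₂ * x) - 9 * (x ^ 2 * x) := by ring
      linarith
    · rw [hR]
      linarith

theorem tester_lower_bound {k q : ℕ} {ε₁ ε₂ γ : ℝ} (hk : 1 ≤ k) (h1 : 0.01 ≤ ε₁) (h12 : ε₁ < ε₂)
    (h2 : ε₂ ≤ 0.49) (hΔ : (2 : ℝ) ^ (-((k : ℝ) ^ (0.1 : ℝ))) ≤ ε₂ - ε₁) (hγk : 1 / (k : ℝ) ≤ γ)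
    (hγ : γ ≤ 1 / 2 ^ 50) (T : RandQueryAlg)
    (hT : T.IsJuntaTester k ⌊(1 + γ) * (k : ℝ)⌋₊ ε₁ ε₂) (hTq : T.MakesAtMost q) :
    (1 / γ) ^ (1 / 800 * (-Real.logb 2 (ε₂ - ε₁))) ≤ (q : ℝ) := by
  by_contra! hlt
  have hk0 : (0 : ℝ) < k := by exact_mod_cast hk
  have hk1 : (1 : ℝ) ≤ k := by exact_mod_cast hk
  have hγ0 : 0 < γ := lt_of_lt_of_le (by positivity) hγk
  set r : ℝ := -Real.logb 2 (ε₂ - ε₁) with hr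
  have hΔ0 : 0 < ε₂ - ε₁ := by linarith
  have hΔr : ε₂ - ε₁ = 2 ^ (-r) := by
    rw [hr, neg_neg, Real.rpow_logb (by norm_num) (by norm_num) hΔ0]
  have hrk : r ≤ (k : ℝ) ^ (0.1 : ℝ) := by
    rw [hΔr, Real.rpow_le_rpow_left_iff (by norm_num)] at hΔ
    linarith
  have hr0 : 0 ≤ r := by
    have : (2 : ℝ) ^ (-r) ≤ 2 ^ (0 : ℝ) := by rw [← hΔr]; norm_num; linarith
    rw [Real.rpow_le_rpow_left_iff (by norm_num)] at this
    linarith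
  set g : ℝ := 1 / γ with hg
  have hgk : g ≤ k := by
    rw [hg, div_le_iff₀ hγ0]
    rw [div_le_iff₀ hk0] at hγk
    linarith
  have hg50 : 2 ^ 50 ≤ g := by
    rw [hg, le_div_iff₀ hγ0]
    have := mul_le_mul_of_nonneg_left hγ (by positivity : (0 : ℝ) ≤ 2 ^ 50)
    linarith
  have hg1 : 1 ≤ g := le_trans (by norm_num) hg50
  have hg0 : 0 < g := by linarith
  set w : ℝ := g ^ (0.1 : ℝ) with hw
  have hw32 : 32 ≤ w := by
    have h : ((2 : ℝ) ^ 50) ^ (0.1 : ℝ) ≤ w := by rw [hw]; gcongr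
    refine le_trans (le_of_eq ?_) h
    rw [← Real.rpow_natCast, ← Real.rpow_mul (by norm_num)]
    norm_num
  have hw10 : w ^ 10 = g := by
    rw [hw, ← Real.rpow_natCast, ← Real.rpow_mul hg0.le]
    norm_num
  set z : ℝ := (k : ℝ) ^ (0.1 : ℝ) with hz
  have hwz : w ≤ z := by rw [hw, hz]; gcongr
  have hz10 : z ^ 10 = k := by
    rw [hz, ← Real.rpow_natCast, ← Real.rpow_mul hk0.le]
    norm_num
  -- So `v` is about `(1/γ) ^ 0.2`: small enough for `384 * l * v ^ 2 < k` and `4 * v * γ ≤ 1`,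
  -- while `v ≥ 16 * w` absorbs the factor `16` in `16 * q ^ 2 ≤ v ^ l`.
  set v : ℕ := ⌊w ^ 2⌋₊ with hv
  have hv1 : (v : ℝ) ≤ w ^ 2 := Nat.floor_le (by positivity)
  have hv2 : w ^ 2 - 1 < v := by linarith [Nat.lt_floor_add_one (w ^ 2)]
  have hv16 : 16 * w ≤ v := by nlinarith
  -- The largest `l` with `ε₂ - ε₁ ≤ 2 ^ (-20 * l)`, or `1` if there is none. Then `r ≤ 40 * l`, so
  -- the exponent `r / 800` is at most `l / 20`, and `q ^ 2 ≤ w ^ l`.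
  set l : ℕ := max 1 ⌊r / 20⌋₊ with hl
  have hfl : (⌊r / 20⌋₊ : ℝ) ≤ r / 20 := Nat.floor_le (by positivity)
  have hlz : (l : ℝ) ≤ z := by
    rw [hl, Nat.cast_max]
    refine max_le ?_ ?_
    · rw [Nat.cast_one]; linarith
    · linarith
  have hl1 : (1 : ℝ) ≤ l := by exact_mod_cast le_max_left _ _
  have hrl : r ≤ 40 * l := by
    have h3 : r / 20 < ⌊r / 20⌋₊ + 1 := Nat.lt_floor_add_one _
    have h4 : (⌊r / 20⌋₊ : ℝ) ≤ l := by exact_mod_cast le_max_right _ _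
    linarith
  have hz0 : 0 < z := by linarith
  refine no_tester_of_params (l := l) (v := v) (q := q) (le_max_left _ _) ?_ ?_ ?_ h1 h12 h2 ?_ ?_
    T hT hTq
  · have : (1 : ℝ) ≤ v := by linarith
    exact_mod_cast this
  · have h3 : (384 : ℝ) * l * v ^ 2 < k := by
      calc (384 : ℝ) * l * v ^ 2 ≤ 384 * z * (z ^ 2) ^ 2 := by
            gcongr
            exact hv1.trans (by gcongr)
        _ < z ^ 5 * z ^ 5 := by
            have : (384 : ℝ) < z ^ 5 := by
              calc (384 : ℝ) < 32 ^ 5 := by norm_num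
                _ ≤ z ^ 5 := by gcongr; linarith
            calc 384 * z * (z ^ 2) ^ 2 = 384 * z ^ 5 := by ring
              _ < _ := by gcongr
        _ = k := by rw [← hz10]; ring
    exact_mod_cast h3
  · have hfloor : (⌊(1 + γ) * (k : ℝ)⌋₊ : ℝ) ≤ (1 + γ) * k := Nat.floor_le (by positivity)
    have hvγ : 4 * v * γ ≤ 1 := by
      have h3 : 4 * (v : ℝ) ≤ g := by
        calc 4 * (v : ℝ) ≤ w ^ 8 * w ^ 2 := by
              gcongr
              calc (4 : ℝ) ≤ 32 ^ 8 := by norm_num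
                _ ≤ w ^ 8 := by gcongr
          _ = g := by rw [← hw10]; ring
      rw [hg, le_div_iff₀ hγ0] at h3
      exact h3
    have h4 : (4 : ℝ) * v * ⌊(1 + γ) * (k : ℝ)⌋₊ ≤ (4 * v + 1) * k := by
      calc (4 : ℝ) * v * ⌊(1 + γ) * (k : ℝ)⌋₊ ≤ 4 * v * ((1 + γ) * k) := by gcongr
        _ = 4 * v * k + 4 * v * γ * k := by ring
        _ ≤ 4 * v * k + 1 * k := by gcongr
        _ = _ := by ring
    exact_mod_cast h4
  · by_cases hl2 : ⌊r / 20⌋₊ ≤ 1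
    · left; rw [hl]; omega
    · right
      have hl' : l = ⌊r / 20⌋₊ := by rw [hl]; omega
      refine ⟨by omega, ?_⟩
      rw [hΔr]
      have h3 : ((1 : ℝ) / 2 ^ 20) ^ l = 2 ^ (-(20 * l : ℝ)) := by
        rw [Real.rpow_neg (by norm_num), one_div, inv_pow, ← pow_mul]
        congr 1
        rw [← Real.rpow_natCast]
        push_cast
        rfl
      rw [h3, Real.rpow_le_rpow_left_iff (by norm_num), hl']
      linarith
  · have hqw : (q : ℝ) * q ≤ w ^ l := by
      have h3 : (q : ℝ) ≤ g ^ ((l : ℝ) / 20) := by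
        refine hlt.le.trans (Real.rpow_le_rpow_of_exponent_le hg1 ?_)
        linarith
      calc (q : ℝ) * q ≤ g ^ ((l : ℝ) / 20) * g ^ ((l : ℝ) / 20) := by gcongr
        _ = w ^ l := by
          rw [← Real.rpow_add hg0, hw, ← Real.rpow_natCast, ← Real.rpow_mul hg0.le]
          congr 1; ring
    have h4 : (16 : ℝ) * (q * q) ≤ v ^ l := by
      calc (16 : ℝ) * (q * q) ≤ 16 ^ l * w ^ l := by
            gcongr
            calc (16 : ℝ) = 16 ^ 1 := by norm_num
              _ ≤ 16 ^ l := pow_le_pow_right₀ (by norm_num) (le_max_left _ _)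
        _ = (16 * w) ^ l := by rw [mul_pow]
        _ ≤ v ^ l := by gcongr
    exact_mod_cast h4

lemma FarFromJuntas.mono {n m m' : ℕ} {ε : ℝ} {f : BoolFun n} (h : FarFromJuntas m' ε f)
    (hm : m ≤ m') : FarFromJuntas m ε f := by
  rintro g ⟨S, hS, hg⟩
  exact h g ⟨S, hS.trans hm, hg⟩

theorem theorem2 :
    (∃ γ₀ c : ℝ, 0 < γ₀ ∧ 0 < c ∧
      ∀ (k : ℕ) (ε₁ ε₂ γ : ℝ), 1 ≤ k →
        0.01 ≤ ε₁ → ε₁ < ε₂ → ε₂ ≤ 0.49 →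
        (2 : ℝ) ^ (-((k : ℝ) ^ (0.1 : ℝ))) ≤ ε₂ - ε₁ →
        1 / (k : ℝ) ≤ γ → γ ≤ γ₀ →
        ∀ T : RandQueryAlg, T.IsJuntaTester k ⌊(1 + γ) * (k : ℝ)⌋₊ ε₁ ε₂ →
          ∀ q : ℕ, T.MakesAtMost q →
            (1 / γ) ^ (c * (-Real.logb 2 (ε₂ - ε₁))) ≤ (q : ℝ)) ∧
    (∀ h : ℕ → ℕ,
      Asymptotics.IsLittleO Filter.atTop (fun k : ℕ => (h k : ℝ)) (fun k : ℕ => (k : ℝ)) →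
      ∀ (C : ℝ) (d : ℕ), ∀ᶠ k : ℕ in Filter.atTop,
        ∀ ε₁ ε₂ : ℝ, 0.01 ≤ ε₁ → ε₁ < ε₂ → ε₂ ≤ 0.49 →
          (2 : ℝ) ^ (-((k : ℝ) ^ (0.1 : ℝ))) ≤ ε₂ - ε₁ → ε₂ - ε₁ ≤ 1 / (k : ℝ) →
          ∀ T : RandQueryAlg, T.IsJuntaTester k (k + h k) ε₁ ε₂ →
            ∀ q : ℕ, T.MakesAtMost q →
              C * ((k : ℝ) * (ε₂ - ε₁)⁻¹) ^ d < (q : ℝ)) := by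
  refine ⟨⟨1 / 2 ^ 50, 1 / 800, by positivity, by norm_num,
    fun k ε₁ ε₂ γ hk h1 h12 h2 hΔ hγk hγ T hT q hTq =>
      tester_lower_bound hk h1 h12 h2 hΔ hγk hγ T hT hTq⟩, ?_⟩
  intro h hh C d
  -- A constant `γ` chosen so that the lower bound becomes `(ε₂ - ε₁)⁻¹ ^ (2 * d + 1)`. As `k ≤ (ε₂
  -- - ε₁)⁻¹`, the power `2 * d` covers the polynomial and the remaining factor beats `C`.
  obtain ⟨γ, hγdef⟩ : ∃ γ : ℝ, γ = 1 / 2 ^ (800 * (2 * d + 1)) := ⟨_, rfl⟩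
  have hγ0 : 0 < γ := by rw [hγdef]; positivity
  have hγ50 : γ ≤ 1 / 2 ^ 50 := by
    rw [hγdef]
    gcongr
    · norm_num
    · omega
  filter_upwards [hh.def hγ0, Filter.eventually_ge_atTop (⌈1 / γ⌉₊ + ⌈|C|⌉₊ + 1)] with k hhk hk
  intro ε₁ ε₂ h1 h12 h2 hΔ hΔk T hT q hTq
  have hk1 : 1 ≤ k := by omega
  have hk0 : (0 : ℝ) < k := by exact_mod_cast hk1
  have hkγ : 1 / γ ≤ k := (Nat.le_ceil _).trans (by exact_mod_cast (by omega))
  have hkC : |C| < k := (Nat.le_ceil _).trans_lt (by exact_mod_cast (by omega))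
  have hγk : 1 / (k : ℝ) ≤ γ := by
    rw [div_le_iff₀ hγ0] at hkγ
    rw [div_le_iff₀ hk0]
    linarith
  simp only [RCLike.norm_natCast] at hhk
  have hfloor : k + h k ≤ ⌊(1 + γ) * (k : ℝ)⌋₊ := by
    refine Nat.le_floor ?_
    push_cast
    linarith
  have hT' : T.IsJuntaTester k ⌊(1 + γ) * (k : ℝ)⌋₊ ε₁ ε₂ := fun n f =>
    ⟨(hT n f).1, fun hf => (hT n f).2 (hf.mono hfloor)⟩
  refine lt_of_lt_of_le ?_ (tester_lower_bound hk1 h1 h12 h2 hΔ hγk hγ50 T hT' hTq)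
  have hΔ0 : 0 < ε₂ - ε₁ := by linarith
  set D : ℝ := (ε₂ - ε₁)⁻¹ with hD
  have hD0 : 0 < D := inv_pos.2 hΔ0
  have hkD : (k : ℝ) ≤ D := by
    rw [hD, le_inv_comm₀ hk0 hΔ0, ← one_div]
    exact hΔk
  have hbound : (1 / γ) ^ (1 / 800 * (-Real.logb 2 (ε₂ - ε₁))) = D ^ (2 * d + 1) := by
    have hDr : D = 2 ^ (-Real.logb 2 (ε₂ - ε₁)) := by
      rw [Real.rpow_neg (by norm_num), Real.rpow_logb (by norm_num) (by norm_num) hΔ0]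
    rw [hγdef, one_div_one_div, hDr, ← Real.rpow_natCast, ← Real.rpow_natCast,
      ← Real.rpow_mul (by norm_num), ← Real.rpow_mul (by norm_num)]
    congr 1
    push_cast
    ring
  rw [hbound]
  calc C * (k * D) ^ d ≤ |C| * (D * D) ^ d := by
        gcongr
        exact le_abs_self C
    _ < D * (D * D) ^ d := by
        gcongr
        exact hkC.trans_le hkD
    _ = D ^ (2 * d + 1) := by ring
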